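/- For an integer $k\ge 3$, consider the free product $G_k=\mathbb Z/k\mathbb Z\star\mathbb Z/k\mathbb Z$, the generators of the two cyclic groups being $a$ and $b$ respectively. Set $\Sigma_1=\{a,\dots,a^{k-1}\}$, $\Sigma_2=\{b,\dots,b^{k-1}\}$ and $\Sigma=\Sigma_1\sqcup\Sigma_2$; for $u\in\Sigma_j$ write $\Sigma_u=\Sigma_j$. Let $|g|_\Sigma$ be the word length of $g\in G_k$ with respect to the generating set $\Sigma$. Every $g\in G_k$ has a unique normal form $g=u_1\cdots u_n$ with $u_i\in\Sigma$ and $u_{i+1}\notin\Sigma_{u_i}$; let $L^\infty\subset\Sigma^{\mathbb N}$ be the set of infinite words satisfying the same condition. Let $(X_n)_{n\ge0}$ be the random walk $X_0=1$, $X_{n+1}=X_nx_n$, with $(x_n)$ i.i.d. of law $\mu$, where $\mu(a)=\mu(a^{-1})=\mu(b)=\mu(b^{-1})=1/4$. The drift of the walk is the constant $\gamma_k=\lim_n |X_n|_\Sigma/n$ (almost surely and in $L^1$). The harmonic measure is the law on $L^\infty$ of the random infinite word $X_\infty$ such that, almost surely, the length of the longest common prefix of the normal form of $X_n$ and of $X_\infty$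 tends to infinity. For $r:\Sigma\to(0,1)$ with $\sum_{u\in\Sigma}r(u)=1$, the Markovian multiplicative measure associated with $r$ is the law on $L^\infty$ of the Markov chain with initial distribution $r$ and transition probabilities $P_{u,v}=r(v)/\sum_{s\in\Sigma\setminus\Sigma_u}r(s)$ if $v\notin\Sigma_u$, and $P_{u,v}=0$ if $v\in\Sigma_u$. Let $F_0(x)=1$, $F_1(x)=x$ and $F_n(x)=2(2-x)F_{n-1}(x)-F_{n-2}(x)$ for $n\ge 2$. **Theorem.** For every $k\ge3$, the equation $F_k(x)=1$ has a unique solution $x_k$ in $(0,1)$; the harmonic measure of the walk exists and is the Markovian multiplicative measure associated with $r(a^i)=r(b^i)=F_i(x_k)/2$, $1\le i\le k-1$ (in particular these numbers are positive and sum to $1$); and the drift exists and equals $\gamma_k=(1-x_k)/2$. Moreover $\gamma_k$ is strictly increasing in $k\ge3$, and $\lim_{k\to\infty}\gamma_k=1/3$. -/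

import Mathlib

open MeasureTheory Filter Topology
open scoped ENNReal

noncomputable section

namespace FreeProductWalk

/-! ### Random walks on a group -/

section Walk

variable {Γ : Type*} [Group Γ]

/-- Length of `g` with respect to `S`: the least `n` such that `g` is a product of `n` elements
of `S`. -/
def wordLength (S : Set Γ) (g : Γ) : ℕ :=
  sInf {n : ℕ | ∃ l : List Γ, l.length = n ∧ (∀ s ∈ l, s ∈ S) ∧ l.prod = g}

/-- The walk with increments `x 0, x 1, …`: `X 0 = 1` and `X (n + 1) = X n * x n`. -/
def walk (x : ℕ → Γ) : ℕ → Γ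
  | 0 => 1
  | n + 1 => walk x n * x n

variable [MeasurableSpace Γ]

/-- The law of a sequence of independent increments with common law `μ`. -/
def incrementLaw (μ : Measure Γ) [IsProbabilityMeasure μ] : Measure (ℕ → Γ) :=
  Measure.infinitePi fun _ : ℕ => μ

/-- `γ` is the drift, with respect to the generators `S`, of the random walk with step law `μ`:
`|X n|_S / n` converges to `γ` almost surely and in `L¹`. -/
structure IsDrift (S : Set Γ) (μ : Measure Γ) [IsProbabilityMeasure μ] (γ : ℝ) : Prop where
  ae_tendsto : ∀ᵐ x ∂(incrementLaw μ),
    Tendsto (fun n : ℕ => (wordLength S (walk x n) : ℝ) / n) atTop (𝓝 γ)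
  tendsto_L1 : Tendsto (fun n : ℕ =>
    eLpNorm (fun x => (wordLength S (walk x n) : ℝ) / n - γ) 1 (incrementLaw μ)) atTop (𝓝 0)

end Walk

/-! ### The group `ℤ/kℤ ⋆ ℤ/kℤ` and its simple random walk -/

/-- The free product `ℤ/kℤ ⋆ ℤ/kℤ`; the factors are indexed by `false` and `true`. -/
abbrev ZkZk (k : ℕ) : Type := Monoid.CoprodI (fun _ : Bool => Multiplicative (ZMod k))

instance (k : ℕ) : MeasurableSpace (ZkZk k) := ⊤

/-- The generator of the first factor. -/
def a (k : ℕ) : ZkZk k :=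
  Monoid.CoprodI.of (M := fun _ : Bool => Multiplicative (ZMod k)) (i := false)
    (Multiplicative.ofAdd 1)

/-- The generator of the second factor. -/
def b (k : ℕ) : ZkZk k :=
  Monoid.CoprodI.of (M := fun _ : Bool => Multiplicative (ZMod k)) (i := true)
    (Multiplicative.ofAdd 1)

/-- The step law `μ(a) = μ(a⁻¹) = μ(b) = μ(b⁻¹) = 1/4`. -/
def stepLaw (k : ℕ) : Measure (ZkZk k) :=
  (4 : ℝ≥0∞)⁻¹ • (Measure.dirac (a k) + Measure.dirac (a k)⁻¹
    + Measure.dirac (b k) + Measure.dirac (b k)⁻¹)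

instance (k : ℕ) : IsProbabilityMeasure (stepLaw k) := by
  constructor
  simp only [stepLaw, Measure.smul_apply, Measure.add_apply, measure_univ, smul_eq_mul]
  rw [show (1 : ℝ≥0∞) + 1 + 1 + 1 = 4 by norm_num]
  exact ENNReal.inv_mul_cancel (by norm_num) (by norm_num)

/-- The alphabet `Σ = Σ₁ ⊔ Σ₂ = {a, …, a^(k-1)} ⊔ {b, …, b^(k-1)}`: the non-identity elements of
the two factors. -/
def Letter (k : ℕ) : Type := {s : Σ _ : Bool, Multiplicative (ZMod k) // s.2 ≠ 1}

instance (k : ℕ) : MeasurableSpace (Letter k) := ⊤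

variable {k : ℕ}

/-- The factor to which a letter belongs. -/
def Letter.factor (s : Letter k) : Bool := s.1.1

/-- The exponent `i ∈ {1, …, k-1}` of the letter `a^i` or `b^i` (for `k ≥ 1`). -/
def Letter.exponent (s : Letter k) : ℕ := ZMod.val (Multiplicative.toAdd s.1.2)

/-- A letter as an element of the group. -/
def Letter.toGroup (s : Letter k) : ZkZk k :=
  Monoid.CoprodI.of (M := fun _ : Bool => Multiplicative (ZMod k)) (i := s.1.1) s.1.2

/-- The set of generators `Σ` of `ℤ/kℤ ⋆ ℤ/kℤ`. -/
def generators (k : ℕ) : Set (ZkZk k) := Set.range (Letter.toGroup (k := k))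

/-- Infinite normal form words: consecutive letters lie in different factors. -/
def Boundary (k : ℕ) : Type :=
  {w : ℕ → Letter k // ∀ n, (w n).factor ≠ (w (n + 1)).factor}

instance (k : ℕ) : MeasurableSpace (Boundary k) :=
  inferInstanceAs (MeasurableSpace
    {w : ℕ → Letter k // ∀ n, (w n).factor ≠ (w (n + 1)).factor})

/-- The letters of the normal form of a group element. -/
def normalForm (g : ZkZk k) : List (Σ _ : Bool, Multiplicative (ZMod k)) :=
  (Monoid.CoprodI.Word.equiv g).toList

/-- Convergence of group elements to an infinite word: for every `m`, the `m`-th letter of the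
normal form is eventually the `m`-th letter of the infinite word. Equivalently, the length of
the longest common prefix tends to infinity. -/
def ConvergesTo (g : ℕ → ZkZk k) (w : Boundary k) : Prop :=
  ∀ m : ℕ, ∀ᶠ n in atTop, (normalForm (g n))[m]? = some (w.1 m).1

/-- `ν` is the harmonic measure of the random walk with step law `μ`: the walk converges almost
surely to a random infinite normal form word, whose law is `ν`. -/
def IsHarmonicMeasure (μ : Measure (ZkZk k)) [IsProbabilityMeasure μ]
    (ν : Measure (Boundary k)) : Prop :=
  ∃ Xinf : (ℕ → ZkZk k) → Boundary k,
    AEMeasurable Xinf (incrementLaw μ) ∧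
    (∀ᵐ x ∂(incrementLaw μ), ConvergesTo (walk x) (Xinf x)) ∧
    (incrementLaw μ).map Xinf = ν

/-! ### Markovian multiplicative measures -/

/-- The transition matrix attached to `r`: `P u v = r v / r(Σ ∖ Σ_u)` if `v` and `u` lie in
different factors, and `P u v = 0` otherwise. -/
def transition (r : Letter k → ℝ) (u v : Letter k) : ℝ :=
  if v.factor = u.factor then 0
  else r v / ∑ᶠ s : {s : Letter k // s.factor ≠ u.factor}, r s.1

/-- `ν` is the Markovian multiplicative measure associated with the positive probability vector
`r` on the alphabet: the law of the Markov chain of letters with initial law `r` and transition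
matrix `transition r`. -/
structure IsMarkovianMultiplicative (r : Letter k → ℝ) (ν : Measure (Boundary k)) : Prop where
  pos : ∀ s, 0 < r s
  sum_eq_one : ∑ᶠ s, r s = 1
  isProbabilityMeasure : IsProbabilityMeasure ν
  cylinder : ∀ (n : ℕ) (u : Fin (n + 1) → Letter k),
    ν {w | ∀ i : Fin (n + 1), w.1 i = u i} =
      ENNReal.ofReal (r (u 0) * ∏ i : Fin n, transition r (u i.castSucc) (u i.succ))

/-! ### The polynomials `F n` -/

/-- `F 0 = 1`, `F 1 = x`, `F n = 2 (2 - x) F (n - 1) - F (n - 2)`. -/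
def F : ℕ → ℝ → ℝ
  | 0, _ => 1
  | 1, x => x
  | n + 2, x => 2 * (2 - x) * F (n + 1) x - F n x

end FreeProductWalk

end

noncomputable section

namespace FreeProductWalk

/-! ### The polynomials `F n` -/

section Polynomials

lemma F_mul_pow {q y : ℝ} (hy : 2 * q * (2 - y) = q ^ 2 + 1) (n : ℕ) :
    F n y * q ^ n * (1 - q ^ 2) = (y - q) * q + (1 - y * q) * q ^ (2 * n) := by
  induction n using Nat.twoStepInduction with
  | zero => simp [F]; ring
  | one => simp [F]; ring
  | more n h0 h1 =>
    have : F (n + 2) y * q ^ (n + 2) * (1 - q ^ 2)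
        = (2 * q * (2 - y)) * (F (n + 1) y * q ^ (n + 1) * (1 - q ^ 2))
          - q ^ 2 * (F n y * q ^ n * (1 - q ^ 2)) := by
      simp only [F]; ring
    rw [this, h0, h1, hy]
    ring

/-- `(1 - q) * rootFun k q = 1 - 3 q + 3 q ^ k - q ^ (k + 1)`; its zero `q` in `(0, 1)`
parametrizes the solution of `F k x = 1` through `x = 2 - (q + q⁻¹) / 2`. -/
def rootFun (k : ℕ) (q : ℝ) : ℝ := (1 - q) ^ 2 - ∑ i ∈ Finset.Ico 2 k, q ^ i * (3 - q)

lemma rootFun_succ {k : ℕ} (hk : 2 ≤ k) (q : ℝ) :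
    rootFun (k + 1) q = rootFun k q - q ^ k * (3 - q) := by
  simp only [rootFun, Finset.sum_Ico_succ_top hk]; ring

lemma one_sub_mul_rootFun {k : ℕ} (hk : 2 ≤ k) (q : ℝ) :
    (1 - q) * rootFun k q = 1 - 3 * q + q ^ k * (3 - q) := by
  induction k, hk using Nat.le_induction with
  | base => simp [rootFun]; ring
  | succ k hk ih => rw [rootFun_succ hk, mul_sub, ih]; ring

lemma rootFun_lt {k : ℕ} {p q : ℝ} (hp : 0 ≤ p) (hpq : p < q) (hq : q ≤ 1) :
    rootFun k q < rootFun k p := by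
  unfold rootFun
  have h1 : (1 - q) ^ 2 < (1 - p) ^ 2 := by nlinarith
  have h2 : ∑ i ∈ Finset.Ico 2 k, p ^ i * (3 - p) ≤ ∑ i ∈ Finset.Ico 2 k, q ^ i * (3 - q) := by
    refine Finset.sum_le_sum fun i hi => ?_
    obtain ⟨j, rfl⟩ : ∃ j, i = j + 1 := ⟨i - 1, by have := Finset.mem_Ico.1 hi; omega⟩
    have h3 : p ^ j ≤ q ^ j := pow_le_pow_left₀ hp hpq.le j
    have h4 : p * (3 - p) ≤ q * (3 - q) := by nlinarith
    calc p ^ (j + 1) * (3 - p) = p ^ j * (p * (3 - p)) := by ring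
      _ ≤ q ^ j * (q * (3 - q)) :=
          mul_le_mul h3 h4 (mul_nonneg hp (by linarith)) (pow_nonneg (hp.trans hpq.le) j)
      _ = q ^ (j + 1) * (3 - q) := by ring
  linarith

lemma rootFun_zero (k : ℕ) : rootFun k 0 = 1 := by
  rw [rootFun, Finset.sum_eq_zero]
  · norm_num
  · intro i hi
    have := Finset.mem_Ico.1 hi
    rw [zero_pow (by omega), zero_mul]

lemma rootFun_one_neg {k : ℕ} (hk : 3 ≤ k) : rootFun k 1 < 0 := by
  have : 0 < ∑ i ∈ Finset.Ico 2 k, (1 : ℝ) ^ i * (3 - 1) := by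
    refine Finset.sum_pos (fun i _ => by norm_num) ⟨2, ?_⟩
    simp; omega
  unfold rootFun
  linarith

lemma continuous_rootFun (k : ℕ) : Continuous (rootFun k) := by
  unfold rootFun; fun_prop

lemma exists_rootFun_eq_zero {k : ℕ} {p : ℝ} (hp : 0 < p) (h : rootFun k p < 0) :
    ∃ q, 0 < q ∧ q < p ∧ rootFun k q = 0 := by
  obtain ⟨q, hq, hq0⟩ := intermediate_value_Ioo' hp.le (continuous_rootFun k).continuousOn
    (show (0 : ℝ) ∈ Set.Ioo (rootFun k p) (rootFun k 0) by rw [rootFun_zero]; exact ⟨h, one_pos⟩)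
  exact ⟨q, hq.1, hq.2, hq0⟩

lemma rootFun_injective {k : ℕ} {p q : ℝ} (hp : 0 < p) (hp1 : p < 1) (hq : 0 < q) (hq1 : q < 1)
    (h : rootFun k p = rootFun k q) : p = q := by
  rcases lt_trichotomy p q with hlt | heq | hgt
  · exact absurd h (rootFun_lt hp.le hlt hq1.le).ne'
  · exact heq
  · exact absurd h (rootFun_lt hq.le hgt hp1.le).ne

lemma F_eq_one_iff {k : ℕ} (hk : 2 ≤ k) {q y : ℝ} (hq : 0 < q) (hq1 : q < 1)
    (hy : 2 * q * (2 - y) = q ^ 2 + 1) : F k y = 1 ↔ rootFun k q = 0 := by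
  have h := F_mul_pow hy k
  have hr := one_sub_mul_rootFun hk q
  have hQ : q ^ k < 1 := pow_lt_one₀ hq.le hq1 (by omega)
  have hQ0 : 0 < q ^ k := pow_pos hq k
  rw [mul_comm 2 k, pow_mul] at h
  set Q := q ^ k
  have key : (F k y - 1) * (2 * q * Q * (1 - q ^ 2))
      = (Q - 1) * ((1 - q) * rootFun k q) * (q * (1 - q)) := by
    rw [hr]
    linear_combination 2 * q * h - (q - Q ^ 2 * q) * hy
  have hne : 2 * q * Q * (1 - q ^ 2) ≠ 0 := by
    have : 0 < 1 - q ^ 2 := by nlinarith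
    positivity
  constructor
  · intro h1
    rw [h1, sub_self, zero_mul] at key
    by_contra h0
    have h1 : (1 - q) ≠ 0 := by linarith
    have h2 : Q - 1 ≠ 0 := by linarith
    exact (mul_ne_zero (mul_ne_zero h2 (mul_ne_zero h1 h0)) (mul_ne_zero hq.ne' h1)) key.symm
  · intro h0
    rw [h0] at key
    have : F k y - 1 = 0 := by
      refine (mul_eq_zero.1 (key.trans ?_)).resolve_right hne
      ring
    linarith

/-- The data of the solution of `F k x = 1`, with its parameter `q`. -/
structure IsSolution (k : ℕ) (q x : ℝ) : Prop where
  q_pos : 0 < q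
  q_lt_one : q < 1
  root : rootFun k q = 0
  rel : 2 * q * (2 - x) = q ^ 2 + 1

lemma exists_isSolution {k : ℕ} (hk : 3 ≤ k) : ∃ q x, IsSolution k q x := by
  obtain ⟨q, h0, h1, h⟩ := exists_rootFun_eq_zero one_pos (rootFun_one_neg hk)
  refine ⟨q, 2 - (q ^ 2 + 1) / (2 * q), h0, h1, h, ?_⟩
  field_simp
  ring

namespace IsSolution

variable {k : ℕ} {q x : ℝ}

lemma q_eq (hk : 3 ≤ k) (h : IsSolution k q x) : 3 * q - 1 = q ^ k * (3 - q) := by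
  have := one_sub_mul_rootFun (show 2 ≤ k by omega) q
  rw [h.root, mul_zero] at this
  linarith

lemma third_lt_q (hk : 3 ≤ k) (h : IsSolution k q x) : 1 / 3 < q := by
  have h1 := h.q_eq hk
  have h2 : 0 < q ^ k * (3 - q) := mul_pos (pow_pos h.q_pos k) (by linarith [h.q_lt_one])
  linarith

lemma x_pos (hk : 3 ≤ k) (h : IsSolution k q x) : 0 < x := by
  have h1 := h.third_lt_q hk
  have h2 := h.rel
  have h3 := h.q_lt_one
  by_contra! hx
  nlinarith

lemma x_lt_one (h : IsSolution k q x) : x < 1 := by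
  have h2 := h.rel
  have h3 := h.q_lt_one
  have h4 := h.q_pos
  by_contra! hx
  nlinarith

lemma F_self (hk : 3 ≤ k) (h : IsSolution k q x) : F k x = 1 :=
  (F_eq_one_iff (by omega) h.q_pos h.q_lt_one h.rel).2 h.root

lemma unique (hk : 3 ≤ k) (h : IsSolution k q x) {y : ℝ} (hy0 : 0 < y) (hy1 : y < 1)
    (hy : F k y = 1) : y = x := by
  have hs : Real.sqrt ((2 - y) ^ 2 - 1) ^ 2 = (2 - y) ^ 2 - 1 := Real.sq_sqrt (by nlinarith)
  have hs0 := Real.sqrt_nonneg ((2 - y) ^ 2 - 1)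
  set s := Real.sqrt ((2 - y) ^ 2 - 1)
  have hp0 : 0 < 2 - y - s := by
    by_contra! hc
    nlinarith
  have hp1 : 2 - y - s < 1 := by
    by_contra! hc
    nlinarith
  have hrel : 2 * (2 - y - s) * (2 - y) = (2 - y - s) ^ 2 + 1 := by linear_combination -hs
  have hroot := (F_eq_one_iff (show 2 ≤ k by omega) hp0 hp1 hrel).1 hy
  have heq := rootFun_injective hp0 hp1 h.q_pos h.q_lt_one (hroot.trans h.root.symm)
  rw [heq] at hrel
  have h3 : q * (y - x) = 0 := by linear_combination (h.rel - hrel) / 2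
  have := (mul_eq_zero.1 h3).resolve_left h.q_pos.ne'
  linarith

lemma F_eq (hk : 3 ≤ k) (h : IsSolution k q x) {n m : ℕ} (hnm : n + m = k) :
    F n x = (q ^ n + q ^ m) / (1 + q ^ k) := by
  have hq := h.q_pos
  have h1 := F_mul_pow h.rel n
  have h2 := h.q_eq hk
  have hQ : 0 < q ^ k := pow_pos hq k
  have h1q : 0 < 1 - q ^ 2 := by nlinarith [h.q_lt_one]
  have hxq : x * q * (1 + q ^ k) = q ^ 2 + q ^ k := by
    linear_combination (-(1 + q ^ k) / 2) * h.rel + ((1 - q) / 2) * h2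
  rw [eq_div_iff (by positivity)]
  have hpos : q ^ n * (1 - q ^ 2) ≠ 0 := by positivity
  apply mul_right_cancel₀ hpos
  have hkk : q ^ k = q ^ n * q ^ m := by rw [← hnm, pow_add]
  calc F n x * (1 + q ^ k) * (q ^ n * (1 - q ^ 2))
      = (F n x * q ^ n * (1 - q ^ 2)) * (1 + q ^ k) := by ring
    _ = (q ^ n + q ^ m) * (q ^ n * (1 - q ^ 2)) := by
      rw [h1, mul_comm 2 n, pow_mul]
      linear_combination (1 - (q ^ n) ^ 2) * hxq + (1 - q ^ 2) * hkk

lemma F_symm (hk : 3 ≤ k) (h : IsSolution k q x) {n m : ℕ} (hnm : n + m = k) :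
    F n x = F m x := by
  rw [h.F_eq hk hnm, h.F_eq hk ((add_comm m n).trans hnm), add_comm]

lemma F_pos (hk : 3 ≤ k) (h : IsSolution k q x) {n : ℕ} (hn : n ≤ k) : 0 < F n x := by
  rw [h.F_eq hk (Nat.add_sub_cancel' hn)]
  have := h.q_pos
  positivity

lemma F_lt_one (hk : 3 ≤ k) (h : IsSolution k q x) {n : ℕ} (hn0 : 0 < n) (hn : n < k) :
    F n x < 1 := by
  rw [h.F_eq hk (Nat.add_sub_cancel' hn.le)]
  have h0 := h.q_pos
  rw [div_lt_one (by positivity)]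
  have h1 : q ^ n < 1 := pow_lt_one₀ h0.le h.q_lt_one (by omega)
  have h2 : q ^ (k - n) < 1 := pow_lt_one₀ h0.le h.q_lt_one (by omega)
  have h3 : q ^ k = q ^ n * q ^ (k - n) := by rw [← pow_add, Nat.add_sub_cancel' hn.le]
  nlinarith

lemma sum_F (hk : 3 ≤ k) (h : IsSolution k q x) : ∑ i ∈ Finset.Ico 1 k, F i x = 1 := by
  have key : ∀ n : ℕ, 2 * (1 - x) * ∑ i ∈ Finset.Ico 1 (n + 1), F i x
      = F (n + 1) x - F n x + 1 - x := by
    intro n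
    induction n with
    | zero => simp [F]
    | succ n ih =>
      rw [Finset.sum_Ico_succ_top (by omega), mul_add, ih]
      simp only [F]; ring
  have h1 := key (k - 1)
  have hx := h.x_lt_one
  rw [Nat.sub_add_cancel (by omega), h.F_self hk,
    h.F_symm hk (show k - 1 + 1 = k by omega)] at h1
  simp only [F] at h1
  apply mul_left_cancel₀ (show 2 * (1 - x) ≠ 0 by linarith)
  linarith

lemma sum_F_mul (hk : 3 ≤ k) (h : IsSolution k q x) :
    (1 - x) * ∑ i ∈ Finset.Ico 1 k, F i x * (i * (k - i)) = k - 2 := by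
  have key : ∀ n : ℕ, 2 * (1 - x) * ∑ i ∈ Finset.Ico 1 (n + 1), F i x * (i * (k - i))
      = - 2 * ∑ i ∈ Finset.Ico 1 (n + 1), F i x
        + (n * (k - n)) * F (n + 1) x - ((n + 1) * (k - (n + 1))) * F n x + (k - 1) := by
    intro n
    induction n with
    | zero => simp [F]
    | succ n ih =>
      rw [Finset.sum_Ico_succ_top (show 1 ≤ n + 1 by omega) (fun i => F i x * (i * (k - i))),
        Finset.sum_Ico_succ_top (show 1 ≤ n + 1 by omega) (fun i => F i x), mul_add, ih]
      simp only [F]; push_cast; ring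
  have h1 := key (k - 1)
  rw [Nat.sub_add_cancel (by omega), h.F_self hk, h.sum_F hk] at h1
  push_cast [Nat.cast_sub (show 1 ≤ k by omega)] at h1
  linear_combination h1 / 2

lemma x_strictAnti {j : ℕ} {p y : ℝ} (hj : 3 ≤ j) (h : IsSolution j p y)
    (h' : IsSolution (j + 1) q x) : x < y := by
  have hp := h.q_pos
  have hp1 := h.q_lt_one
  have hneg : rootFun (j + 1) p < 0 := by
    rw [rootFun_succ (by omega), h.root]
    have : 0 < p ^ j * (3 - p) := mul_pos (pow_pos hp j) (by linarith)
    linarith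
  obtain ⟨r, hr0, hr1, hr⟩ := exists_rootFun_eq_zero hp hneg
  have hrq := rootFun_injective hr0 (hr1.trans hp1) h'.q_pos h'.q_lt_one (hr.trans h'.root.symm)
  subst hrq
  have e1 : r * p * (y - x) = (p - r) * (1 - r * p) / 2 := by
    linear_combination (p * h'.rel - r * h.rel) / 2
  have : 0 < (p - r) * (1 - r * p) / 2 := by
    have : r * p < 1 := by nlinarith
    have := mul_pos (sub_pos.2 hr1) (sub_pos.2 this)
    linarith
  have := pos_of_mul_pos_right (e1 ▸ this) (mul_pos hr0 hp).le
  linarith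

end IsSolution

lemma tendsto_solution {q x : ℕ → ℝ} (h : ∀ k, 3 ≤ k → IsSolution k (q k) (x k)) :
    Tendsto x atTop (𝓝 (1 / 3)) := by
  have hle : ∀ k, 3 ≤ k → q k ≤ q 3 := by
    intro k hk
    have h3 := h 3 le_rfl
    by_contra! hc
    have := rootFun_lt (k := k) h3.q_pos.le hc (h k hk).q_lt_one.le
    rw [(h k hk).root] at this
    have hle : rootFun k (q 3) ≤ rootFun 3 (q 3) := by
      unfold rootFun
      have : ∑ i ∈ Finset.Ico 2 3, q 3 ^ i * (3 - q 3) ≤ ∑ i ∈ Finset.Ico 2 k, q 3 ^ i * (3 - q 3) :=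
        Finset.sum_le_sum_of_subset_of_nonneg (Finset.Ico_subset_Ico_right hk) fun i _ _ =>
          mul_nonneg (pow_nonneg h3.q_pos.le i) (by linarith [h3.q_lt_one])
      linarith
    rw [h3.root] at hle
    linarith
  have hpow : Tendsto (fun k => 3 * q 3 ^ k) atTop (𝓝 (3 * 0)) :=
    (tendsto_pow_atTop_nhds_zero_of_lt_one (h 3 le_rfl).q_pos.le (h 3 le_rfl).q_lt_one).const_mul 3
  have hq : Tendsto q atTop (𝓝 (1 / 3)) := by
    have hup : Tendsto (fun k => 1 / 3 + (3 * q 3 ^ k)) atTop (𝓝 (1 / 3)) := by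
      have := hpow.const_add (1 / 3)
      rwa [mul_zero, add_zero] at this
    refine tendsto_of_tendsto_of_tendsto_of_le_of_le' tendsto_const_nhds hup ?_ ?_
    · filter_upwards [eventually_ge_atTop 3] with k hk using ((h k hk).third_lt_q hk).le
    · filter_upwards [eventually_ge_atTop 3] with k hk
      have h1 := (h k hk).q_eq hk
      have h2 : q k ^ k ≤ q 3 ^ k := pow_le_pow_left₀ (h k hk).q_pos.le (hle k hk) k
      have h3 := pow_pos (h k hk).q_pos k
      nlinarith [(h k hk).q_pos]
  have hx : Tendsto (fun k => 2 - (q k ^ 2 + 1) / (2 * q k)) atTop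
      (𝓝 (2 - ((1 / 3) ^ 2 + 1) / (2 * (1 / 3)))) :=
    (((hq.pow 2).add_const 1).div (hq.const_mul 2) (by norm_num)).const_sub 2
  norm_num at hx
  refine (hx.congr' ?_).trans (by norm_num)
  filter_upwards [eventually_ge_atTop 3] with k hk
  have := (h k hk).rel
  have h0 := (h k hk).q_pos
  field_simp
  linarith

end Polynomials

/-! ### Normal forms -/

section NormalForm

variable {k : ℕ}

/-- A syllable: an element of one of the two factors. -/
abbrev Syllable (k : ℕ) : Type := Σ _ : Bool, Multiplicative (ZMod k)

/-- The group element given by an element of the factor `i`. -/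
abbrev ofFactor (i : Bool) (m : Multiplicative (ZMod k)) : ZkZk k :=
  Monoid.CoprodI.of (M := fun _ : Bool => Multiplicative (ZMod k)) (i := i) m

/-- A list of syllables which is a normal form. -/
def Reduced (L : List (Syllable k)) : Prop :=
  (∀ l ∈ L, l.2 ≠ 1) ∧ L.IsChain fun l l' => l.1 ≠ l'.1

/-- The product in the group of a list of syllables. -/
def listProd (L : List (Syllable k)) : ZkZk k := (L.map fun l => ofFactor l.1 l.2).prod

lemma listProd_append (L L' : List (Syllable k)) :
    listProd (L ++ L') = listProd L * listProd L' := by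
  simp [listProd]

lemma reduced_normalForm (g : ZkZk k) : Reduced (normalForm g) :=
  ⟨(Monoid.CoprodI.Word.equiv g).ne_one, (Monoid.CoprodI.Word.equiv g).chain_ne⟩

lemma listProd_normalForm (g : ZkZk k) : listProd (normalForm g) = g :=
  Monoid.CoprodI.Word.equiv.symm_apply_apply g

lemma normalForm_listProd {L : List (Syllable k)} (h : Reduced L) :
    normalForm (listProd L) = L :=
  congrArg Monoid.CoprodI.Word.toList
    (Monoid.CoprodI.Word.equiv.apply_symm_apply
      (⟨L, h.1, h.2⟩ : Monoid.CoprodI.Word fun _ : Bool => Multiplicative (ZMod k)))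

lemma normalForm_eq_iff {g : ZkZk k} {L : List (Syllable k)} :
    normalForm g = L ↔ Reduced L ∧ listProd L = g :=
  ⟨fun h => h ▸ ⟨reduced_normalForm g, listProd_normalForm g⟩,
    fun h => h.2 ▸ normalForm_listProd h.1⟩

lemma normalForm_injective : Function.Injective (normalForm (k := k)) := fun g h e => by
  rw [← listProd_normalForm g, e, listProd_normalForm]

lemma reduced_nil : Reduced ([] : List (Syllable k)) := ⟨by simp, by simp⟩

@[simp] lemma normalForm_one : normalForm (1 : ZkZk k) = [] :=
  normalForm_eq_iff.2 ⟨reduced_nil, by simp [listProd]⟩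

lemma normalForm_eq_nil_iff {g : ZkZk k} : normalForm g = [] ↔ g = 1 :=
  ⟨fun h => normalForm_injective (h.trans normalForm_one.symm), fun h => h ▸ normalForm_one⟩

lemma reduced_append {L L' : List (Syllable k)} :
    Reduced (L ++ L') ↔ Reduced L ∧ Reduced L' ∧
      ∀ l ∈ L.getLast?, ∀ l' ∈ L'.head?, l.1 ≠ l'.1 := by
  simp only [Reduced, List.isChain_append, List.forall_mem_append]
  tauto

/-- The list with the single syllable `⟨i, m⟩`, or the empty list if `m = 1`. -/
def tail (i : Bool) (m : Multiplicative (ZMod k)) : List (Syllable k) :=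
  if m = 1 then [] else [⟨i, m⟩]

@[simp] lemma tail_one (i : Bool) : tail i (1 : Multiplicative (ZMod k)) = [] := if_pos rfl

lemma tail_of_ne {i : Bool} {m : Multiplicative (ZMod k)} (h : m ≠ 1) : tail i m = [⟨i, m⟩] :=
  if_neg h

lemma normalForm_listProd_mul {L : List (Syllable k)} (h : Reduced L) {i : Bool}
    (hi : ∀ l ∈ L.getLast?, l.1 ≠ i) (m : Multiplicative (ZMod k)) :
    normalForm (listProd L * ofFactor i m) = L ++ tail i m := by
  rw [normalForm_eq_iff]
  by_cases hm : m = 1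
  · subst hm
    simpa using h
  · rw [tail_of_ne hm, listProd_append, reduced_append]
    refine ⟨⟨h, ⟨by simpa using hm, by simp⟩, ?_⟩, by simp [listProd]⟩
    intro l hl l' hl'
    simp only [List.head?_cons, Option.mem_def, Option.some.injEq] at hl'
    subst hl'
    exact hi l hl

lemma normalForm_mul_same {g : ZkZk k} {L : List (Syllable k)} {j : Bool}
    {m : Multiplicative (ZMod k)} (h : normalForm g = L ++ [⟨j, m⟩])
    (m' : Multiplicative (ZMod k)) :
    normalForm (g * ofFactor j m') = L ++ tail j (m * m') := by
  obtain ⟨hr, hg⟩ := normalForm_eq_iff.1 h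
  rw [reduced_append] at hr
  have : g = listProd L * ofFactor j m := by
    rw [← hg, listProd_append]; simp [listProd]
  rw [this, mul_assoc, ← map_mul]
  exact normalForm_listProd_mul hr.1 (fun l hl => hr.2.2 l hl _ rfl) _

lemma normalForm_mul_other {g : ZkZk k} {L : List (Syllable k)} {j : Bool}
    {m : Multiplicative (ZMod k)} (h : normalForm g = L ++ [⟨j, m⟩]) {i : Bool} (hij : i ≠ j)
    (m' : Multiplicative (ZMod k)) :
    normalForm (g * ofFactor i m') = L ++ [⟨j, m⟩] ++ tail i m' := by
  obtain ⟨hr, hg⟩ := normalForm_eq_iff.1 h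
  rw [← hg]
  refine normalForm_listProd_mul hr ?_ m'
  intro l hl
  simp only [List.getLast?_append, List.getLast?_singleton, Option.some_or, Option.mem_def,
    Option.some.injEq] at hl
  subst hl
  exact hij.symm

lemma normalForm_ofFactor (i : Bool) (m : Multiplicative (ZMod k)) :
    normalForm (ofFactor i m) = tail i m := by
  simpa [listProd] using normalForm_listProd_mul (reduced_nil (k := k)) (i := i) (by simp) m

lemma eq_one_or_exists_last (g : ZkZk k) :
    g = 1 ∨ ∃ L j m, m ≠ 1 ∧ normalForm g = L ++ [⟨j, m⟩] := by
  rcases List.eq_nil_or_concat (normalForm g) with h | ⟨L, l, h⟩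
  · exact Or.inl (normalForm_eq_nil_iff.1 h)
  · refine Or.inr ⟨L, l.1, l.2, (reduced_normalForm g).1 l (h ▸ by simp), by simpa using h⟩

lemma tail_length_le (i : Bool) (m : Multiplicative (ZMod k)) : (tail i m).length ≤ 1 := by
  unfold tail; split_ifs <;> simp

lemma exists_normalForm_mul (g : ZkZk k) (i : Bool) (m : Multiplicative (ZMod k)) :
    ∃ L A B : List (Syllable k), A.length ≤ 1 ∧ B.length ≤ 1 ∧
      normalForm g = L ++ A ∧ normalForm (g * ofFactor i m) = L ++ B := by
  rcases eq_one_or_exists_last g with rfl | ⟨L, j, m', hm', h⟩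
  · exact ⟨[], [], tail i m, by simp, tail_length_le i m, by simp,
      by rw [one_mul, normalForm_ofFactor, List.nil_append]⟩
  · by_cases hij : i = j
    · subst hij
      exact ⟨L, _, tail i (m' * m), by simp, tail_length_le _ _, h, normalForm_mul_same h m⟩
    · exact ⟨L ++ [⟨j, m'⟩], [], tail i m, by simp, tail_length_le _ _, by simpa using h,
        normalForm_mul_other h hij m⟩

/-- The number of syllables of the normal form. -/
def len (g : ZkZk k) : ℕ := (normalForm g).length

@[simp] lemma len_one : len (1 : ZkZk k) = 0 := by simp [len]

lemma len_mul_ofFactor_le (g : ZkZk k) (i : Bool) (m : Multiplicative (ZMod k)) :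
    len (g * ofFactor i m) ≤ len g + 1 := by
  obtain ⟨L, A, B, hA, hB, h1, h2⟩ := exists_normalForm_mul g i m
  simp only [len, h1, h2, List.length_append]
  omega

lemma wordLength_generators (g : ZkZk k) : wordLength (generators k) g = len g := by
  have hmem : len g ∈ {n : ℕ | ∃ l : List (ZkZk k), l.length = n ∧
      (∀ s ∈ l, s ∈ generators k) ∧ l.prod = g} := by
    refine ⟨(normalForm g).map fun l : Syllable k => ofFactor l.1 l.2, by simp [len], ?_,
      listProd_normalForm g⟩
    intro s hs
    obtain ⟨l, hl, rfl⟩ := List.mem_map.1 hs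
    exact ⟨⟨l, (reduced_normalForm g).1 l hl⟩, rfl⟩
  refine le_antisymm (Nat.sInf_le hmem) (le_csInf ⟨_, hmem⟩ ?_)
  clear hmem
  rintro n ⟨l, rfl, hl, rfl⟩
  induction l using List.reverseRecOn with
  | nil => simp
  | append_singleton l s ih =>
    obtain ⟨u, rfl⟩ := hl s (by simp)
    rw [List.prod_append, List.prod_singleton, List.length_append, List.length_singleton]
    exact (len_mul_ofFactor_le _ _ _).trans
      (Nat.add_le_add_right (ih fun s hs => hl s (by simp [hs])) 1)

lemma len_mul_le (g h : ZkZk k) : len (g * h) ≤ len g + len h := by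
  have key : ∀ L : List (Syllable k), len (g * listProd L) ≤ len g + L.length := by
    intro L
    induction L using List.reverseRecOn with
    | nil => simp [listProd]
    | append_singleton L l ih =>
      have : listProd (L ++ [l]) = listProd L * ofFactor l.1 l.2 := by
        rw [listProd_append]; simp [listProd]
      rw [this, ← mul_assoc, List.length_append, List.length_singleton]
      exact (len_mul_ofFactor_le _ _ _).trans (by omega)
  simpa [listProd_normalForm, len] using key (normalForm h)

lemma normalForm_inv (g : ZkZk k) :
    normalForm g⁻¹ = (normalForm g).reverse.map fun l => ⟨l.1, l.2⁻¹⟩ := by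
  rw [normalForm_eq_iff]
  obtain ⟨h1, h2⟩ := reduced_normalForm g
  refine ⟨⟨?_, ?_⟩, ?_⟩
  · intro l hl
    obtain ⟨l', hl', rfl⟩ := List.mem_map.1 hl
    simpa using h1 l' (List.mem_reverse.1 hl')
  · rw [List.isChain_map, List.isChain_reverse]
    exact h2.imp fun _ _ h => h.symm
  · conv_rhs => rw [← listProd_normalForm g]
    simp only [listProd, List.map_map, List.prod_inv_reverse, List.map_reverse]
    simp [Function.comp_def]

/-- `g` begins with a syllable of the factor `c`. -/
def StartsIn (c : Bool) (g : ZkZk k) : Prop := ∃ l ∈ (normalForm g).head?, l.1 = c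

lemma startsIn_iff {g w : ZkZk k} {L : List (Syllable k)} {j : Bool}
    {m : Multiplicative (ZMod k)} (h : normalForm w = L ++ [⟨j, m⟩]) :
    StartsIn (!j) (w⁻¹ * g) ↔
      normalForm w <+: normalForm g ∧ (normalForm w).length < (normalForm g).length := by
  have hw := reduced_normalForm w
  constructor
  · rintro ⟨l, hl, hlj⟩
    have hr := reduced_normalForm (w⁻¹ * g)
    have : normalForm g = normalForm w ++ normalForm (w⁻¹ * g) := by
      rw [normalForm_eq_iff, listProd_append, listProd_normalForm, listProd_normalForm,
        reduced_append]
      refine ⟨⟨hw, hr, ?_⟩, by group⟩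
      intro s hs s' hs'
      rw [h] at hs
      simp only [List.getLast?_append, List.getLast?_singleton, Option.some_or, Option.mem_def,
        Option.some.injEq] at hs
      subst hs
      rw [Option.mem_unique hs' hl, hlj]
      simp
    rw [this]
    refine ⟨List.prefix_append _ _, ?_⟩
    rcases hn : normalForm (w⁻¹ * g) with _ | ⟨s, t⟩
    · simp [hn] at hl
    · simp
  · rintro ⟨⟨L', hL'⟩, hlen⟩
    have hr := reduced_normalForm g
    rw [← hL', reduced_append] at hr
    have hnf : normalForm (w⁻¹ * g) = L' := by
      rw [normalForm_eq_iff]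
      refine ⟨hr.2.1, ?_⟩
      rw [eq_inv_mul_iff_mul_eq, ← listProd_normalForm g, ← hL', listProd_append,
        listProd_normalForm]
    rcases L' with _ | ⟨s, t⟩
    · simp [← hL'] at hlen
    · refine ⟨s, by simp [hnf], ?_⟩
      have := hr.2.2 ⟨j, m⟩ (by rw [h]; simp) s (by simp)
      revert this
      cases j <;> cases s.1 <;> simp

lemma a_eq : a k = ofFactor false (Multiplicative.ofAdd 1) := rfl

lemma b_eq : b k = ofFactor true (Multiplicative.ofAdd 1) := rfl

lemma a_inv_eq : (a k)⁻¹ = ofFactor false (Multiplicative.ofAdd (-1)) := by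
  rw [a_eq, ofAdd_neg, ← map_inv]

lemma b_inv_eq : (b k)⁻¹ = ofFactor true (Multiplicative.ofAdd (-1)) := by
  rw [b_eq, ofAdd_neg, ← map_inv]

end NormalForm

/-! ### Averaging functions over a step of the walk -/

section Average

variable {k : ℕ}

/-- The mean of `f` after one step of the walk from `g`. -/
def avg (f : ZkZk k → ℝ) (g : ZkZk k) : ℝ :=
  (f (g * a k) + f (g * (a k)⁻¹) + f (g * b k) + f (g * (b k)⁻¹)) / 4

lemma avg_eq (f : ZkZk k → ℝ) (g : ZkZk k) (j : Bool) :
    avg f g = (f (g * ofFactor j (Multiplicative.ofAdd 1))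
      + f (g * ofFactor j (Multiplicative.ofAdd (-1)))
      + f (g * ofFactor (!j) (Multiplicative.ofAdd 1))
      + f (g * ofFactor (!j) (Multiplicative.ofAdd (-1)))) / 4 := by
  rw [avg, a_inv_eq, b_inv_eq, a_eq, b_eq]
  cases j
  · rfl
  · simp only [Bool.not_true]; ring

/-- The multiplicative function on normal forms with weight `w m` at the syllable `m`. -/
def weight (w : ZMod k → ℝ) (g : ZkZk k) : ℝ :=
  ((normalForm g).map fun l => w (Multiplicative.toAdd l.2)).prod

variable {w : ZMod k → ℝ}

@[simp] lemma weight_one : weight w 1 = 1 := by simp [weight]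

lemma weight_nonneg (h : ∀ m, 0 ≤ w m) (g : ZkZk k) : 0 ≤ weight w g :=
  List.prod_nonneg fun y hy => by
    obtain ⟨l, _, rfl⟩ := List.mem_map.1 hy
    exact h _

lemma prod_tail (h0 : w 0 = 1) (i : Bool) (m : ZMod k) :
    ((tail i (Multiplicative.ofAdd m)).map fun l => w (Multiplicative.toAdd l.2)).prod = w m := by
  unfold tail
  split_ifs with h
  · rw [ofAdd_eq_one] at h
    simp [h, h0]
  · simp

lemma avg_weight_one (h0 : w 0 = 1) : avg (weight w) 1 = (w 1 + w (-1)) / 2 := by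
  rw [avg_eq _ _ true]
  simp only [one_mul, weight, normalForm_ofFactor, prod_tail h0]
  ring

lemma avg_weight (h0 : w 0 = 1) {g : ZkZk k} {L : List (Syllable k)} {j : Bool} {m : ZMod k}
    (h : normalForm g = L ++ [⟨j, Multiplicative.ofAdd m⟩]) :
    avg (weight w) g = (L.map fun l => w (Multiplicative.toAdd l.2)).prod *
      (w (m + 1) + w (m - 1) + w m * (w 1 + w (-1))) / 4 := by
  rw [avg_eq _ _ j]
  simp only [weight, normalForm_mul_same h, normalForm_mul_other h (show (!j) ≠ j by simp),
    ← ofAdd_add, List.map_append, List.prod_append, prod_tail h0, ← sub_eq_add_neg]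
  simp only [List.map_cons, List.map_nil, List.prod_cons, List.prod_nil, toAdd_ofAdd]
  ring

lemma avg_weight_le (h0 : w 0 = 1) (hw : ∀ m, 0 ≤ w m) {ρ : ℝ}
    (h : ∀ m ≠ 0, w (m + 1) + w (m - 1) + w m * (w 1 + w (-1)) ≤ 4 * ρ * w m)
    {g : ZkZk k} (hg : g ≠ 1) : avg (weight w) g ≤ ρ * weight w g := by
  obtain ⟨L, j, m, hm, hL⟩ := (eq_one_or_exists_last g).resolve_left hg
  rw [avg_weight h0 (m := Multiplicative.toAdd m) hL, weight, hL]
  simp only [List.map_append, List.prod_append, List.map_cons, List.map_nil, List.prod_cons,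
    List.prod_nil, mul_one]
  have hnn : 0 ≤ (L.map fun l => w (Multiplicative.toAdd l.2)).prod :=
    List.prod_nonneg fun y hy => by
      obtain ⟨l, _, rfl⟩ := List.mem_map.1 hy
      exact hw _
  have := mul_le_mul_of_nonneg_left (h (Multiplicative.toAdd m) hm) hnn
  linarith

lemma avg_weight_eq (h0 : w 0 = 1)
    (h : ∀ m ≠ 0, w (m + 1) + w (m - 1) + w m * (w 1 + w (-1)) = 4 * w m)
    {g : ZkZk k} (hg : g ≠ 1) : avg (weight w) g = weight w g := by
  obtain ⟨L, j, m, hm, hL⟩ := (eq_one_or_exists_last g).resolve_left hg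
  rw [avg_weight h0 (m := Multiplicative.toAdd m) hL, weight, hL]
  simp only [List.map_append, List.prod_append, List.map_cons, List.map_nil, List.prod_cons,
    List.prod_nil, mul_one]
  have := h (Multiplicative.toAdd m) hm
  linear_combination (L.map fun l => w (Multiplicative.toAdd l.2)).prod / 4 * this

lemma weight_inv (hs : ∀ m, w (-m) = w m) (g : ZkZk k) : weight w g⁻¹ = weight w g := by
  rw [weight, normalForm_inv, List.map_map, List.map_reverse, List.prod_reverse, weight]
  congr 1
  refine List.map_congr_left fun l _ => ?_
  simp [hs]

end Average

/-! ### Expectations along the walk -/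

section Walk

variable {Γ : Type*} [Group Γ]

lemma walk_congr {x y : ℕ → Γ} {n : ℕ} (h : ∀ i < n, x i = y i) : walk x n = walk y n := by
  induction n with
  | zero => rfl
  | succ n ih =>
    simp only [walk]
    rw [ih fun i hi => h i (by omega), h n (by omega)]

variable [MeasurableSpace Γ]

instance (μ : Measure Γ) [IsProbabilityMeasure μ] : IsProbabilityMeasure (incrementLaw μ) := by
  unfold incrementLaw; infer_instance

variable [DiscreteMeasurableSpace Γ] [Countable Γ]

lemma measurable_walk (n : ℕ) : Measurable fun x : ℕ → Γ => walk x n := by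
  induction n with
  | zero => exact measurable_const
  | succ n ih =>
    exact (Measurable.of_discrete (f := fun p : Γ × Γ => p.1 * p.2)).comp
      (ih.prodMk (measurable_pi_apply n))

lemma lintegral_walk_succ (μ : Measure Γ) [IsProbabilityMeasure μ] (f : Γ → ℝ≥0∞) (n : ℕ) :
    ∫⁻ x, f (walk x (n + 1)) ∂(incrementLaw μ)
      = ∫⁻ x, ∫⁻ s, f (walk x n * s) ∂μ ∂(incrementLaw μ) := by
  have hind : ProbabilityTheory.iIndepFun (fun (i : ℕ) (x : ℕ → Γ) => x i) (incrementLaw μ) :=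
    ProbabilityTheory.iIndepFun_infinitePi (P := fun _ : ℕ => μ) (X := fun _ => id)
      fun _ => measurable_id
  have hfin := hind.indepFun_finset (Finset.range n) {n} (by simp) fun i => measurable_pi_apply i
  let φ : (Finset.range n → Γ) → Γ := fun y =>
    walk (fun i => if h : i ∈ Finset.range n then y ⟨i, h⟩ else 1) n
  have hφ : Measurable φ := by
    refine (measurable_walk n).comp (measurable_pi_lambda _ fun i => ?_)
    by_cases h : i ∈ Finset.range n
    · simpa only [h, dite_true] using measurable_pi_apply _
    · simpa only [h, dite_false] using measurable_const
  have hpair : ProbabilityTheory.IndepFun (fun x : ℕ → Γ => walk x n) (fun x => x n)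
      (incrementLaw μ) := by
    have h := hfin.comp hφ (measurable_pi_apply (⟨n, by simp⟩ : ({n} : Finset ℕ)))
    have hw : (φ ∘ fun (x : ℕ → Γ) (i : Finset.range n) => x i) = fun x => walk x n := by
      ext x
      exact walk_congr fun i hi => by simp [hi]
    rwa [hw] at h
  have hmap : (incrementLaw μ).map (fun x => x n) = μ :=
    Measure.infinitePi_map_eval (fun _ : ℕ => μ) n
  have hjoint := (ProbabilityTheory.indepFun_iff_map_prod_eq_prod_map_map
    (measurable_walk n).aemeasurable (measurable_pi_apply n).aemeasurable).1 hpair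
  rw [hmap] at hjoint
  have h1 : ∫⁻ x, f (walk x (n + 1)) ∂(incrementLaw μ)
      = ∫⁻ p, f (p.1 * p.2) ∂((incrementLaw μ).map fun x => (walk x n, x n)) := by
    rw [lintegral_map Measurable.of_discrete
      ((measurable_walk n).prodMk (measurable_pi_apply n))]
    rfl
  rw [h1, hjoint, lintegral_prod _ Measurable.of_discrete.aemeasurable,
    lintegral_map Measurable.of_discrete (measurable_walk n)]

end Walk

section Lyapunov

variable {k : ℕ}

instance : Countable (ZkZk k) := by
  have : Countable (List (Syllable k)) := by
    have : Countable (ZMod k) := by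
      cases k with
      | zero => exact inferInstanceAs (Countable ℤ)
      | succ n => exact inferInstanceAs (Countable (Fin (n + 1)))
    have : Countable (Multiplicative (ZMod k)) := this
    infer_instance
  exact normalForm_injective.countable

instance : DiscreteMeasurableSpace (ZkZk k) := ⟨fun _ => trivial⟩

lemma lintegral_stepLaw {f : ZkZk k → ℝ} (hf : ∀ g, 0 ≤ f g) (g : ZkZk k) :
    ∫⁻ s, ENNReal.ofReal (f (g * s)) ∂(stepLaw k) = ENNReal.ofReal (avg f g) := by
  have h1 := hf (g * a k)
  have h2 := hf (g * (a k)⁻¹)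
  have h3 := hf (g * b k)
  have h4 := hf (g * (b k)⁻¹)
  rw [stepLaw, lintegral_smul_measure, lintegral_add_measure, lintegral_add_measure,
    lintegral_add_measure, lintegral_dirac, lintegral_dirac, lintegral_dirac, lintegral_dirac,
    ← ENNReal.ofReal_add h1 h2, ← ENNReal.ofReal_add (by positivity) h3,
    ← ENNReal.ofReal_add (by positivity) h4, avg, div_eq_inv_mul,
    ENNReal.ofReal_mul (by norm_num), ENNReal.ofReal_inv_of_pos (by norm_num)]
  simp

lemma lintegral_walk_of_avg_eq {f : ZkZk k → ℝ} (hf : ∀ g, 0 ≤ f g)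
    (h : ∀ g, avg f g = f g) (n : ℕ) :
    ∫⁻ x, ENNReal.ofReal (f (walk x n)) ∂(incrementLaw (stepLaw k)) = ENNReal.ofReal (f 1) := by
  induction n with
  | zero => simp [walk]
  | succ n ih =>
    rw [lintegral_walk_succ (stepLaw k) (fun g => ENNReal.ofReal (f g)), ← ih]
    simp_rw [lintegral_stepLaw hf, h]

lemma lintegral_walk_of_avg_le {f : ZkZk k → ℝ} (hf : ∀ g, 0 ≤ f g) {ρ : ℝ} (hρ : 0 ≤ ρ)
    (h : ∀ g, avg f g ≤ ρ * f g) (n : ℕ) :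
    ∫⁻ x, ENNReal.ofReal (f (walk x n)) ∂(incrementLaw (stepLaw k))
      ≤ ENNReal.ofReal (ρ ^ n * f 1) := by
  induction n with
  | zero => simp [walk]
  | succ n ih =>
    rw [lintegral_walk_succ (stepLaw k) (fun g => ENNReal.ofReal (f g))]
    simp_rw [lintegral_stepLaw hf]
    calc ∫⁻ x, ENNReal.ofReal (avg f (walk x n)) ∂(incrementLaw (stepLaw k))
        ≤ ∫⁻ x, ENNReal.ofReal ρ * ENNReal.ofReal (f (walk x n)) ∂(incrementLaw (stepLaw k)) := by
          refine lintegral_mono fun x => ?_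
          rw [← ENNReal.ofReal_mul hρ]
          exact ENNReal.ofReal_le_ofReal (h _)
      _ ≤ ENNReal.ofReal ρ * ENNReal.ofReal (ρ ^ n * f 1) := by
          rw [lintegral_const_mul' _ _ ENNReal.ofReal_ne_top]
          gcongr
      _ = ENNReal.ofReal (ρ ^ (n + 1) * f 1) := by
          rw [← ENNReal.ofReal_mul hρ]; ring_nf

/-- Borel-Cantelli for a Lyapunov function. -/
lemma ae_tendsto_zero_of_avg_le {f : ZkZk k → ℝ} (hf : ∀ g, 0 ≤ f g) {ρ κ : ℝ} (hρ : 0 ≤ ρ)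
    (hκ : 0 ≤ κ) (hρκ : κ * ρ < 1) (h : ∀ g, avg f g ≤ ρ * f g) :
    ∀ᵐ x ∂(incrementLaw (stepLaw k)),
      Tendsto (fun n => κ ^ n * f (walk x n)) atTop (𝓝 0) := by
  have hm : ∀ n, Measurable fun x : ℕ → ZkZk k => ENNReal.ofReal (κ ^ n * f (walk x n)) :=
    fun n => (Measurable.of_discrete (f := fun g => ENNReal.ofReal (κ ^ n * f g))).comp
      (measurable_walk n)
  have hsum : ∫⁻ x, ∑' n, ENNReal.ofReal (κ ^ n * f (walk x n)) ∂(incrementLaw (stepLaw k)) ≠ ⊤ := by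
    rw [lintegral_tsum fun n => (hm n).aemeasurable]
    have hs : Summable fun n : ℕ => (κ * ρ) ^ n * f 1 :=
      (summable_geometric_of_lt_one (mul_nonneg hκ hρ) hρκ).mul_right _
    refine ne_top_of_le_ne_top hs.tsum_ofReal_ne_top (ENNReal.tsum_le_tsum fun n => ?_)
    simp_rw [ENNReal.ofReal_mul (pow_nonneg hκ n)]
    rw [lintegral_const_mul' _ _ ENNReal.ofReal_ne_top, mul_pow, mul_assoc,
      ENNReal.ofReal_mul (pow_nonneg hκ n)]
    gcongr
    exact lintegral_walk_of_avg_le hf hρ h n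
  filter_upwards [ae_lt_top (Measurable.tsum hm) hsum] with x hx
  have := (ENNReal.tendsto_toReal ENNReal.zero_ne_top).comp
    (ENNReal.tendsto_atTop_zero_of_tsum_ne_top hx.ne)
  refine (this.congr fun n => ?_)
  simp only [Function.comp_apply]
  exact ENNReal.toReal_ofReal (mul_nonneg (pow_nonneg hκ n) (hf _))

lemma ae_forall_exists_ofFactor :
    ∀ᵐ x ∂(incrementLaw (stepLaw k)), ∀ n, ∃ i m, x n = ofFactor i m := by
  rw [ae_all_iff]
  intro n
  have hmap : (incrementLaw (stepLaw k)).map (fun x => x n) = stepLaw k :=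
    Measure.infinitePi_map_eval (fun _ : ℕ => stepLaw k) n
  have : ∀ᵐ s ∂(stepLaw k), ∃ i m, s = ofFactor i m := by
    rw [ae_iff, stepLaw, Measure.smul_apply]
    simp only [Measure.add_apply, Measure.dirac_apply' _ (MeasurableSet.of_discrete), smul_eq_mul]
    rw [Set.indicator_of_notMem, Set.indicator_of_notMem, Set.indicator_of_notMem,
      Set.indicator_of_notMem]
    · simp
    · exact fun h => h ⟨_, _, b_inv_eq⟩
    · exact fun h => h ⟨_, _, b_eq⟩
    · exact fun h => h ⟨_, _, a_inv_eq⟩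
    · exact fun h => h ⟨_, _, a_eq⟩
  rw [← hmap] at this
  exact ae_of_ae_map (measurable_pi_apply n).aemeasurable this

lemma weight_const (c : ℝ) (g : ZkZk k) :
    weight (fun m => if m = 0 then 1 else c) g = c ^ len g := by
  have : ∀ l ∈ normalForm g, (fun l : Syllable k =>
      if Multiplicative.toAdd l.2 = 0 then (1 : ℝ) else c) l = (fun _ => c) l := fun l hl =>
    if_neg ((reduced_normalForm g).1 l hl)
  rw [weight, List.map_congr_left this]
  simp [len]

lemma ae_tendsto_len (hk : 3 ≤ k) :
    ∀ᵐ x ∂(incrementLaw (stepLaw k)), Tendsto (fun n => len (walk x n)) atTop atTop := by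
  have : Fact (1 < k) := ⟨by omega⟩
  have h11 : (1 : ZMod k) ≠ 0 := one_ne_zero
  have h12 : (2 : ZMod k) ≠ 0 := by
    intro h
    have : ((2 : ℕ) : ZMod k) = 0 := by exact_mod_cast h
    rw [ZMod.natCast_eq_zero_iff] at this
    exact absurd (Nat.le_of_dvd (by omega) this) (by omega)
  set w : ZMod k → ℝ := fun m => if m = 0 then 1 else 3 / 4 with hw
  have hw0 : w 0 = 1 := if_pos rfl
  have hwne : ∀ m, m ≠ 0 → w m = 3 / 4 := fun m hm => if_neg hm
  have hwnn : ∀ m, 0 ≤ w m := fun m => by simp only [hw]; split_ifs <;> norm_num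
  have hwle : ∀ m, w m ≤ 1 := fun m => by simp only [hw]; split_ifs <;> norm_num
  have h1 : w 1 = 3 / 4 := hwne _ h11
  have h2 : w (-1) = 3 / 4 := hwne _ (neg_ne_zero.2 h11)
  have hle : ∀ g, avg (weight w) g ≤ 23 / 24 * weight w g := by
    intro g
    by_cases hg : g = 1
    · subst hg
      rw [avg_weight_one hw0, weight_one, h1, h2]; norm_num
    · refine avg_weight_le hw0 hwnn (fun m hm => ?_) hg
      rw [hwne m hm, h1, h2]
      have : w (m + 1) + w (m - 1) ≤ 7 / 4 := by
        by_cases hm1 : m = 1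
        · subst hm1
          have : w (1 + 1) = 3 / 4 := hwne _ (by rwa [one_add_one_eq_two])
          rw [this]; linarith [hwle (1 - 1)]
        · rw [hwne (m - 1) (sub_ne_zero.2 hm1)]; linarith [hwle (m + 1)]
      linarith
  filter_upwards [ae_tendsto_zero_of_avg_le (weight_nonneg hwnn) (ρ := 23 / 24) (κ := 1)
    (by norm_num) (by norm_num) (by norm_num) hle] with x hx
  simp only [one_pow, one_mul, hw, weight_const] at hx
  refine tendsto_atTop.2 fun m => ?_
  filter_upwards [hx.eventually_lt_const (show (0 : ℝ) < (3 / 4) ^ m by positivity)] with n hn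
  exact ((pow_lt_pow_iff_right_of_lt_one₀ (by norm_num) (by norm_num)).1 hn).le

end Lyapunov

/-! ### Convergence to the boundary -/

section Boundary

variable {k : ℕ}

/-- The first `m` syllables of an infinite word. -/
def firstSyllables (w : Boundary k) (m : ℕ) : List (Syllable k) :=
  (List.range m).map fun i => (w.1 i).1

lemma getElem?_firstSyllables (w : Boundary k) {m i : ℕ} (h : i < m) :
    (firstSyllables w m)[i]? = some (w.1 i).1 := by
  simp [firstSyllables, h]

lemma ConvergesTo.unique {g : ℕ → ZkZk k} {w w' : Boundary k} (h : ConvergesTo g w)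
    (h' : ConvergesTo g w') : w = w' := by
  refine Subtype.ext (funext fun m => Subtype.ext ?_)
  obtain ⟨n, h1, h2⟩ := ((h m).and (h' m)).exists
  exact Option.some_injective _ (h1.symm.trans h2)

lemma ConvergesTo.eventually_take {g : ℕ → ZkZk k} {w : Boundary k} (h : ConvergesTo g w)
    (m : ℕ) : ∀ᶠ n in atTop, (normalForm (g n)).take m = firstSyllables w m := by
  have : ∀ᶠ n in atTop, ∀ i ∈ Finset.range m, (normalForm (g n))[i]? = some (w.1 i).1 :=
    (Filter.eventually_all_finset _).2 fun i _ => h i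
  filter_upwards [this] with n hn
  refine List.ext_getElem? fun i => ?_
  rw [List.getElem?_take]
  split_ifs with hi
  · rw [hn i (Finset.mem_range.2 hi), getElem?_firstSyllables w hi]
  · simp [firstSyllables, not_lt.1 hi]

/-- A nearest neighbour path escaping to infinity converges to an infinite word, and at the time
`e m` of the last visit to the words of length `m` it is at the prefix of length `m`. -/
lemma exists_boundary {X : ℕ → ZkZk k} (h0 : X 0 = 1)
    (hstep : ∀ n, ∃ i m, X (n + 1) = X n * ofFactor i m)
    (hlen : Tendsto (fun n => len (X n)) atTop atTop) :
    ∃ w : Boundary k, ConvergesTo X w ∧ ∃ e : ℕ → ℕ, ∀ m,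
      normalForm (X (e m)) = firstSyllables w m ∧ ∀ n, e m < n → m < len (X n) := by
  have hex : ∀ m, ∃ N, len (X N) ≤ m ∧ ∀ n, N < n → m < len (X n) := by
    intro m
    obtain ⟨N, hN⟩ := eventually_atTop.1 (hlen.eventually_gt_atTop m)
    refine ⟨Nat.findGreatest (fun n => len (X n) ≤ m) N, ?_, ?_⟩
    · exact Nat.findGreatest_spec (P := fun n => len (X n) ≤ m) (Nat.zero_le N) (by simp [h0])
    · intro n hn
      rcases le_total N n with h | h
      · exact hN n h
      · exact not_le.1 (Nat.findGreatest_is_greatest (P := fun n => len (X n) ≤ m) hn h)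
  choose e he1 he2 using hex
  have hstep' : ∀ n, ∃ L A B : List (Syllable k), A.length ≤ 1 ∧ B.length ≤ 1 ∧
      normalForm (X n) = L ++ A ∧ normalForm (X (n + 1)) = L ++ B := fun n => by
    obtain ⟨i, m, h⟩ := hstep n
    rw [h]
    exact exists_normalForm_mul _ _ _
  have hlen_e : ∀ m, len (X (e m)) = m := by
    intro m
    have h1 := he2 m (e m + 1) (by omega)
    have h2 := he1 m
    obtain ⟨L, A, B, hA, hB, h3, h4⟩ := hstep' (e m)
    simp only [len, h3, h4, List.length_append] at h1 h2 ⊢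
    omega
  have htake : ∀ m n, e m ≤ n → (normalForm (X n)).take m = normalForm (X (e m)) := by
    intro m n hn
    induction n, hn using Nat.le_induction with
    | base => exact List.take_of_length_le (hlen_e m).le
    | succ n hn ih =>
      rw [← ih]
      obtain ⟨L, A, B, hA, hB, h3, h4⟩ := hstep' n
      have h1 := he2 m (n + 1) (by omega)
      have h2 : m ≤ len (X n) := by
        rcases hn.eq_or_lt with h | h
        · rw [← h, hlen_e]
        · exact (he2 m n h).le
      simp only [len, h3, h4, List.length_append] at h1 h2
      rw [h3, h4, List.take_append_of_le_length (by omega),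
        List.take_append_of_le_length (by omega)]
  have hlt : ∀ m, m < (normalForm (X (e (m + 1)))).length := fun m => by
    have := hlen_e (m + 1)
    rw [len] at this
    omega
  have hget : ∀ m n, e (m + 1) ≤ n →
      (normalForm (X n))[m]? = some ((normalForm (X (e (m + 1))))[m]'(hlt m)) := by
    intro m n hn
    rw [← List.getElem?_eq_getElem, ← htake _ _ hn, List.getElem?_take_of_lt (by omega)]
  let u : ℕ → Letter k := fun m => ⟨(normalForm (X (e (m + 1))))[m]'(hlt m),
    (reduced_normalForm _).1 _ (List.getElem_mem _)⟩
  let w : Boundary k := ⟨u, fun m => by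
    have h1 := hget m (max (e (m + 1)) (e (m + 2))) (le_max_left _ _)
    have h2 := hget (m + 1) (max (e (m + 1)) (e (m + 2))) (le_max_right _ _)
    obtain ⟨h3, h4⟩ := List.getElem?_eq_some_iff.1 h1
    obtain ⟨h5, h6⟩ := List.getElem?_eq_some_iff.1 h2
    have := List.isChain_iff_getElem.1
      (reduced_normalForm (X (max (e (m + 1)) (e (m + 2))))).2 m h5
    rwa [h4, h6] at this⟩
  refine ⟨w, fun m => eventually_atTop.2 ⟨e (m + 1), fun n hn => hget m n hn⟩, e, fun m => ⟨?_, he2 m⟩⟩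
  refine List.ext_getElem? fun i => ?_
  by_cases hi : i < m
  · rw [getElem?_firstSyllables w hi, ← htake m (max (e m) (e (i + 1))) (le_max_left _ _),
      List.getElem?_take_of_lt hi, hget i _ (le_max_right _ _)]
  · have h1 : (normalForm (X (e m))).length ≤ i := (hlen_e m).le.trans (not_lt.1 hi)
    rw [List.getElem?_eq_none h1, List.getElem?_eq_none (by simpa [firstSyllables] using hi)]

lemma exists_measurable_limit (hk : 3 ≤ k) :
    ∃ Y : (ℕ → ZkZk k) → Boundary k, Measurable Y ∧
      ∀ᵐ x ∂(incrementLaw (stepLaw k)), ConvergesTo (walk x) (Y x) ∧ ∃ e : ℕ → ℕ, ∀ m,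
        normalForm (walk x (e m)) = firstSyllables (Y x) m ∧
          ∀ n, e m < n → m < len (walk x n) := by
  have hae : ∀ᵐ x ∂(incrementLaw (stepLaw k)), ∃ w, ConvergesTo (walk x) w ∧
      ∃ e : ℕ → ℕ, ∀ m, normalForm (walk x (e m)) = firstSyllables w m ∧
        ∀ n, e m < n → m < len (walk x n) := by
    filter_upwards [ae_forall_exists_ofFactor, ae_tendsto_len hk] with x hx1 hx2
    refine exists_boundary rfl (fun n => ?_) hx2
    obtain ⟨i, m, h⟩ := hx1 n
    exact ⟨i, m, by rw [← h]; rfl⟩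
  obtain ⟨x0, w0, -⟩ := hae.exists
  obtain ⟨T, hT, hTm, hT0⟩ := exists_measurable_superset_of_null hae
  have hT' : ∀ x, x ∉ T → ∃ w, ConvergesTo (walk x) w ∧
      ∃ e : ℕ → ℕ, ∀ m, normalForm (walk x (e m)) = firstSyllables w m ∧
        ∀ n, e m < n → m < len (walk x n) := fun x hx => by
    by_contra hc
    exact hx (hT hc)
  classical
  let Y : (ℕ → ZkZk k) → Boundary k := fun x => if h : x ∈ T then w0 else (hT' x h).choose
  have hYT : ∀ x (h : x ∉ T), Y x = (hT' x h).choose := fun x h => by simp only [Y, h, dite_false]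
  refine ⟨Y, ?_, ?_⟩
  · refine Measurable.subtype_mk (p := fun w : ℕ → Letter k => ∀ n, (w n).factor ≠ (w (n + 1)).factor)
      (f := fun x => (Y x).1) (h := fun x => (Y x).2) (measurable_pi_lambda _ fun m => ?_)
    have : Countable (Letter k) := by
      have : Function.Injective (Letter.toGroup (k := k)) := fun u v h => by
        have h' := congrArg normalForm h
        simp only [Letter.toGroup, normalForm_ofFactor, tail_of_ne u.2, tail_of_ne v.2] at h'
        exact Subtype.ext (List.singleton_injective h')
      exact this.countable
    refine measurable_to_countable' fun u => ?_
    have hset : (fun x => (Y x).1 m) ⁻¹' {u} =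
        (T ∩ {_x | w0.1 m = u}) ∪ (Tᶜ ∩ {x | ∀ᶠ n in atTop, (normalForm (walk x n))[m]? = some u.1}) := by
      ext x
      by_cases hx : x ∈ T
      · simp [Y, hx]
      · simp only [Set.mem_preimage, Set.mem_singleton_iff, Set.mem_union, Set.mem_inter_iff, hx,
          false_and, false_or, Set.mem_compl_iff, not_false_iff, true_and, Set.mem_ofPred_eq]
        have hc := (hT' x hx).choose_spec.1 m
        rw [hYT x hx]
        constructor
        · rintro rfl
          exact hc
        · intro h
          obtain ⟨n, h1, h2⟩ := (hc.and h).exists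
          exact Subtype.ext (Option.some_injective _ (h1.symm.trans h2))
    rw [hset]
    refine (hTm.inter (MeasurableSet.const _)).union (hTm.compl.inter ?_)
    simp only [eventually_atTop, Set.ofPred_exists, Set.ofPred_forall]
    refine MeasurableSet.iUnion fun N => MeasurableSet.iInter fun n => MeasurableSet.iInter fun _ => ?_
    exact (MeasurableSet.of_discrete (s := {g : ZkZk k | (normalForm g)[m]? = some u.1})).preimage
      (measurable_walk n)
  · filter_upwards [measure_eq_zero_iff_ae_notMem.1 hT0] with x hx
    rw [hYT x hx]
    exact (hT' x hx).choose_spec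

end Boundary

/-! ### The harmonic function -/

section Harmonic

variable {k : ℕ}

lemma apply_val_natCast {f : ℕ → ℝ} (hk : 3 ≤ k) (hf : f k = f 0) {n : ℕ} (hn : n ≤ k) :
    f (n : ZMod k).val = f n := by
  rcases hn.eq_or_lt with rfl | h
  · rw [ZMod.natCast_self, ZMod.val_zero, hf]
  · rw [ZMod.val_natCast_of_lt h]

lemma exists_natCast (hk : 3 ≤ k) (m : ZMod k) : ∃ n < k, m = (n : ZMod k) := by
  have : NeZero k := ⟨by omega⟩
  exact ⟨m.val, ZMod.val_lt m, (ZMod.natCast_zmod_val m).symm⟩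

lemma exists_natCast_of_ne_zero (hk : 3 ≤ k) {m : ZMod k} (hm : m ≠ 0) :
    ∃ n < k, 1 ≤ n ∧ m = (n : ZMod k) := by
  obtain ⟨n, hn, rfl⟩ := exists_natCast hk m
  refine ⟨n, hn, Nat.one_le_iff_ne_zero.2 ?_, rfl⟩
  rintro rfl
  simp at hm

/-- A relation between the values of `f` at consecutive integers, transported to `ZMod k`. -/
lemma val_neighbours {f : ℕ → ℝ} (hk : 3 ≤ k) (hf : f k = f 0) {P : ℝ → ℝ → ℝ → Prop}
    (h : ∀ n, n + 2 ≤ k → P (f n) (f (n + 1)) (f (n + 2))) {m : ZMod k} (hm : m ≠ 0) :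
    P (f (m - 1).val) (f m.val) (f (m + 1).val) := by
  obtain ⟨n, hn, hn1, rfl⟩ := exists_natCast_of_ne_zero hk hm
  obtain ⟨j, rfl⟩ : ∃ j, n = j + 1 := ⟨n - 1, by omega⟩
  have h1 : ((j + 1 : ℕ) : ZMod k) - 1 = (j : ℕ) := by push_cast; ring
  have h2 : ((j + 1 : ℕ) : ZMod k) + 1 = (j + 2 : ℕ) := by push_cast; ring
  rw [h1, h2, apply_val_natCast hk hf (by omega), apply_val_natCast hk hf (by omega),
    apply_val_natCast hk hf (by omega)]
  exact h j (by omega)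

lemma val_symm {f : ℕ → ℝ} (hk : 3 ≤ k) (hf : ∀ n m, n + m = k → f n = f m) (m : ZMod k) :
    f (-m).val = f m.val := by
  have hf0 : f k = f 0 := hf k 0 rfl
  obtain ⟨n, hn, rfl⟩ := exists_natCast hk m
  have h1 : -((n : ℕ) : ZMod k) = ((k - n : ℕ) : ZMod k) := by
    rw [Nat.cast_sub hn.le, ZMod.natCast_self, zero_sub]
  rw [h1, apply_val_natCast hk hf0 (by omega), apply_val_natCast hk hf0 hn.le]
  exact hf _ _ (by omega)

lemma val_one_eq {f : ℕ → ℝ} (hk : 3 ≤ k) : f (1 : ZMod k).val = f 1 := by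
  have : Fact (1 < k) := ⟨by omega⟩
  rw [ZMod.val_one]

/-- The probability of hitting `1` from an element of a factor. -/
def hitWeight (k : ℕ) (x : ℝ) (m : ZMod k) : ℝ := F m.val x

lemma hitWeight_zero (x : ℝ) : hitWeight k x 0 = 1 := by simp [hitWeight, F]

namespace IsSolution

variable {q x : ℝ}

lemma hitWeight_neg (hk : 3 ≤ k) (h : IsSolution k q x) (m : ZMod k) :
    hitWeight k x (-m) = hitWeight k x m :=
  val_symm (f := fun n => F n x) hk (fun _ _ => h.F_symm hk) m

lemma hitWeight_one (hk : 3 ≤ k) : hitWeight k x 1 = x := val_one_eq (f := fun n => F n x) hk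

lemma hitWeight_pos (hk : 3 ≤ k) (h : IsSolution k q x) (m : ZMod k) : 0 < hitWeight k x m := by
  have : NeZero k := ⟨by omega⟩
  exact h.F_pos hk (ZMod.val_lt m).le

lemma hitWeight_lt_one (hk : 3 ≤ k) (h : IsSolution k q x) {m : ZMod k} (hm : m ≠ 0) :
    hitWeight k x m < 1 := by
  have : NeZero k := ⟨by omega⟩
  exact h.F_lt_one hk (Nat.pos_of_ne_zero (by simpa using hm)) (ZMod.val_lt m)

/-- The probability of hitting `1` is harmonic off `1`. -/
lemma avg_weight_hitWeight (hk : 3 ≤ k) (h : IsSolution k q x) {g : ZkZk k} (hg : g ≠ 1) :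
    avg (weight (hitWeight k x)) g = weight (hitWeight k x) g := by
  refine avg_weight_eq (hitWeight_zero x) (fun m hm => ?_) hg
  rw [h.hitWeight_neg hk, hitWeight_one hk]
  refine val_neighbours (f := fun n => F n x)
    (P := fun u v w => w + u + v * (x + x) = 4 * v) hk (h.F_self hk) (fun n _ => ?_) hm
  simp only [F]; ring

lemma weight_hitWeight_nonneg (hk : 3 ≤ k) (h : IsSolution k q x) (g : ZkZk k) :
    0 ≤ weight (hitWeight k x) g := weight_nonneg (fun m => (h.hitWeight_pos hk m).le) g

lemma exists_weight_le (hk : 3 ≤ k) (h : IsSolution k q x) :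
    ∃ c, 0 ≤ c ∧ c < 1 ∧ ∀ g : ZkZk k, weight (hitWeight k x) g ≤ c ^ len g := by
  have : NeZero k := ⟨by omega⟩
  have hc : ∃ c, 0 ≤ c ∧ c < 1 ∧ ∀ m : ZMod k, m ≠ 0 → hitWeight k x m ≤ c := by
    have : Fact (1 < k) := ⟨by omega⟩
    obtain ⟨m0, hm0, hmax⟩ := Finset.exists_max_image (Finset.univ.filter fun m : ZMod k => m ≠ 0)
      (hitWeight k x) ⟨1, by simp⟩
    exact ⟨hitWeight k x m0, (h.hitWeight_pos hk m0).le,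
      h.hitWeight_lt_one hk (by simpa using hm0), fun m hm => hmax m (by simpa using hm)⟩
  obtain ⟨c, hc0, hc1, hc⟩ := hc
  refine ⟨c, hc0, hc1, fun g => ?_⟩
  have key : ∀ L : List (Syllable k), (∀ l ∈ L, l.2 ≠ 1) →
      (L.map fun l => hitWeight k x (Multiplicative.toAdd l.2)).prod ≤ c ^ L.length := by
    intro L hL
    induction L with
    | nil => simp
    | cons l L ih =>
      rw [List.map_cons, List.prod_cons, List.length_cons, pow_succ']
      refine mul_le_mul (hc _ (hL l (by simp))) (ih fun l hl => hL l (by simp [hl])) ?_ hc0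
      refine List.prod_nonneg fun y hy => ?_
      obtain ⟨l, _, rfl⟩ := List.mem_map.1 hy
      exact (h.hitWeight_pos hk _).le
  exact key _ (reduced_normalForm g).1

lemma weight_le_one (hk : 3 ≤ k) (h : IsSolution k q x) (g : ZkZk k) :
    weight (hitWeight k x) g ≤ 1 := by
  obtain ⟨c, hc0, hc1, hc⟩ := h.exists_weight_le hk
  exact (hc g).trans (pow_le_one₀ hc0 hc1.le)

end IsSolution

open Classical in
/-- The probability that the limit of the walk started at `g` starts in the factor `c`. -/
def startProb (k : ℕ) (x : ℝ) (c : Bool) (g : ZkZk k) : ℝ :=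
  if StartsIn c g then 1 - weight (hitWeight k x) g / 2 else weight (hitWeight k x) g / 2

lemma startsIn_mul_ofFactor {g : ZkZk k} (hg : g ≠ 1) (i c : Bool) (m : Multiplicative (ZMod k))
    (hgm : g * ofFactor i m ≠ 1) : StartsIn c (g * ofFactor i m) ↔ StartsIn c g := by
  obtain ⟨L, j, m', hm', hL⟩ := (eq_one_or_exists_last g).resolve_left hg
  by_cases hij : i = j
  · subst hij
    have h2 := normalForm_mul_same hL m
    rw [StartsIn, StartsIn, hL, h2]
    rcases L with _ | ⟨l, L⟩
    · have hne : m' * m ≠ 1 := by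
        intro h0
        rw [h0, tail_one, List.append_nil] at h2
        exact hgm (normalForm_eq_nil_iff.1 h2)
      rw [tail_of_ne hne]
      simp
    · simp
  · rw [StartsIn, StartsIn, normalForm_mul_other hL hij, hL]
    rcases L with _ | ⟨l, L⟩ <;> simp

lemma startProb_mul_ofFactor (x : ℝ) {g : ZkZk k} (hg : g ≠ 1) (i c : Bool)
    (m : Multiplicative (ZMod k)) [Decidable (StartsIn c g)] :
    startProb k x c (g * ofFactor i m) = if StartsIn c g
      then 1 - weight (hitWeight k x) (g * ofFactor i m) / 2
      else weight (hitWeight k x) (g * ofFactor i m) / 2 := by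
  by_cases hgm : g * ofFactor i m = 1
  · rw [hgm, startProb, weight_one]
    split_ifs <;> norm_num
  · simp only [startProb, startsIn_mul_ofFactor hg i c m hgm]

lemma startsIn_ofFactor {i c : Bool} {m : Multiplicative (ZMod k)} (hm : m ≠ 1) :
    StartsIn c (ofFactor i m) ↔ i = c := by
  rw [StartsIn, normalForm_ofFactor, tail_of_ne hm]
  simp

namespace IsSolution

variable {q x : ℝ}

lemma avg_startProb (hk : 3 ≤ k) (h : IsSolution k q x) (c : Bool) (g : ZkZk k) :
    avg (startProb k x c) g = startProb k x c g := by
  classical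
  by_cases hg : g = 1
  · subst hg
    have : Fact (1 < k) := ⟨by omega⟩
    have h1 : Multiplicative.ofAdd (1 : ZMod k) ≠ 1 := by simp
    have h2 : Multiplicative.ofAdd (-1 : ZMod k) ≠ 1 := by simp
    have h3 : ¬ StartsIn c (1 : ZkZk k) := by simp [StartsIn]
    rw [avg_eq _ _ c]
    simp only [one_mul, startProb, startsIn_ofFactor h1, startsIn_ofFactor h2, h3, if_true, if_false,
      weight_one, Bool.not_eq_self]
    simp only [weight, normalForm_ofFactor, prod_tail (hitWeight_zero x), h.hitWeight_neg hk]
    ring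
  · have := h.avg_weight_hitWeight hk hg
    rw [avg_eq _ _ c] at this ⊢
    simp only [startProb_mul_ofFactor x hg]
    rw [startProb]
    split_ifs <;> linarith

lemma startProb_nonneg (hk : 3 ≤ k) (h : IsSolution k q x) (c : Bool) (g : ZkZk k) :
    0 ≤ startProb k x c g := by
  have h1 := h.weight_hitWeight_nonneg hk g
  have h2 := h.weight_le_one hk g
  unfold startProb
  split_ifs <;> linarith

lemma startProb_le_one (hk : 3 ≤ k) (h : IsSolution k q x) (c : Bool) (g : ZkZk k) :
    startProb k x c g ≤ 1 := by
  have h1 := h.weight_hitWeight_nonneg hk g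
  have h2 := h.weight_le_one hk g
  unfold startProb
  split_ifs <;> linarith

/-- The probability that the limit of the walk starts with the normal form of `w`. -/
lemma measure_prefix (hk : 3 ≤ k) (h : IsSolution k q x) {Y : (ℕ → ZkZk k) → Boundary k}
    (hY : Measurable Y)
    (hlim : ∀ᵐ ω ∂(incrementLaw (stepLaw k)), ConvergesTo (walk ω) (Y ω)) {w : ZkZk k}
    (hw : w ≠ 1) :
    incrementLaw (stepLaw k) {ω | firstSyllables (Y ω) (len w) = normalForm w} =
      ENNReal.ofReal (weight (hitWeight k x) w / 2) := by
  classical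
  obtain ⟨L, j, m, hm, hL⟩ := (eq_one_or_exists_last w).resolve_left hw
  set S : Set (ℕ → ZkZk k) := {ω | firstSyllables (Y ω) (len w) = normalForm w} with hS
  have hSm : MeasurableSet S := by
    have : S = ⋂ i ∈ Finset.range (len w), {ω | some ((Y ω).1 i).1 = (normalForm w)[i]?} := by
      ext ω
      simp only [hS, Set.mem_ofPred_eq, Set.mem_iInter, Finset.mem_range]
      constructor
      · intro h i hi
        rw [← h, getElem?_firstSyllables _ hi]
      · intro h
        refine List.ext_getElem? fun i => ?_
        by_cases hi : i < len w
        · rw [getElem?_firstSyllables _ hi, h i hi]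
        · rw [List.getElem?_eq_none (by simpa [firstSyllables] using hi),
            List.getElem?_eq_none (not_lt.1 hi)]
    rw [this]
    refine Finset.measurableSet_biInter _ fun i _ => ?_
    have hmi : Measurable fun ω => (Y ω).1 i :=
      (measurable_pi_apply i).comp (measurable_subtype_coe.comp hY)
    exact hmi (t := {u : Letter k | some u.1 = (normalForm w)[i]?}) trivial
  set f : ZkZk k → ℝ := fun g => startProb k x (!j) (w⁻¹ * g) with hf
  have hf0 : ∀ g, 0 ≤ f g := fun g => h.startProb_nonneg hk _ _
  have havg : ∀ g, avg f g = f g := fun g => by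
    change avg f g = startProb k x (!j) (w⁻¹ * g)
    rw [← h.avg_startProb hk]
    simp only [hf, avg, mul_assoc]
  have hf1 : f 1 = weight (hitWeight k x) w / 2 := by
    have hns : ¬ StartsIn (!j) w⁻¹ := by
      rw [StartsIn, normalForm_inv, hL]
      simp
    rw [hf]
    simp only [mul_one]
    rw [startProb, if_neg hns, weight_inv (h.hitWeight_neg hk)]
  have hint := lintegral_walk_of_avg_eq hf0 havg
  rw [hf1] at hint
  have hlim2 : Tendsto (fun n => ∫⁻ ω, ENNReal.ofReal (f (walk ω n)) ∂(incrementLaw (stepLaw k)))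
      atTop (𝓝 (∫⁻ ω, S.indicator 1 ω ∂(incrementLaw (stepLaw k)))) := by
    refine tendsto_lintegral_of_dominated_convergence (fun _ => 1) (fun n => ?_) (fun n => ?_)
      (by simp) ?_
    · exact (Measurable.of_discrete (f := fun g => ENNReal.ofReal (f g))).comp (measurable_walk n)
    · refine Eventually.of_forall fun ω => ?_
      simpa using h.startProb_le_one hk (!j) (w⁻¹ * walk ω n)
    · filter_upwards [hlim, ae_tendsto_len hk] with ω hω hlen
      have hweight : Tendsto (fun n => weight (hitWeight k x) (w⁻¹ * walk ω n)) atTop (𝓝 0) := by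
        obtain ⟨c, hc0, hc1, hc⟩ := h.exists_weight_le hk
        have hlen' : Tendsto (fun n => len (w⁻¹ * walk ω n)) atTop atTop := by
          refine tendsto_atTop.2 fun N => ?_
          filter_upwards [hlen.eventually_ge_atTop (N + len w)] with n hn
          have := len_mul_le w (w⁻¹ * walk ω n)
          rw [mul_inv_cancel_left] at this
          omega
        exact squeeze_zero (fun n => h.weight_hitWeight_nonneg hk _) (fun n => hc _)
          ((tendsto_pow_atTop_nhds_zero_of_lt_one hc0 hc1).comp hlen')
      have hev : ∀ᶠ n in atTop, StartsIn (!j) (w⁻¹ * walk ω n) ↔ ω ∈ S := by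
        filter_upwards [hω.eventually_take (len w), hlen.eventually_gt_atTop (len w)] with n h1 h2
        rw [startsIn_iff hL, List.prefix_iff_eq_take, hS, Set.mem_ofPred_eq, ← h1]
        constructor
        · exact fun h => h.1.symm
        · exact fun h => ⟨h.symm, h2⟩
      by_cases hωS : ω ∈ S
      · rw [Set.indicator_of_mem hωS, Pi.one_apply, ← ENNReal.ofReal_one]
        refine ENNReal.tendsto_ofReal ?_
        have : Tendsto (fun n => 1 - weight (hitWeight k x) (w⁻¹ * walk ω n) / 2) atTop
            (𝓝 1) := by simpa using (hweight.div_const 2).const_sub 1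
        refine this.congr' ?_
        filter_upwards [hev] with n hn
        simp only [hf, startProb, hn, hωS, if_true]
      · rw [Set.indicator_of_notMem hωS, ← ENNReal.ofReal_zero]
        refine ENNReal.tendsto_ofReal ?_
        have : Tendsto (fun n => weight (hitWeight k x) (w⁻¹ * walk ω n) / 2) atTop
            (𝓝 0) := by simpa using hweight.div_const 2
        refine this.congr' ?_
        filter_upwards [hev] with n hn
        simp only [hf, startProb, hn, hωS, if_false]
  simp_rw [hint] at hlim2
  rw [lintegral_indicator_one hSm] at hlim2
  exact (tendsto_nhds_unique hlim2 tendsto_const_nhds)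

end IsSolution

end Harmonic

/-! ### The harmonic measure -/

section HarmonicMeasure

variable {k : ℕ}

/-- The letter with a given factor and exponent. -/
def mkLetter (c : Bool) {n : ℕ} (hn : 1 ≤ n ∧ n < k) : Letter k :=
  ⟨⟨c, Multiplicative.ofAdd (n : ZMod k)⟩, by
    rw [Ne, ofAdd_eq_one, ZMod.natCast_eq_zero_iff]
    exact fun h => absurd (Nat.le_of_dvd (by omega) h) (by omega)⟩

lemma factor_mkLetter (c : Bool) {n : ℕ} (hn : 1 ≤ n ∧ n < k) : (mkLetter c hn).factor = c := rfl

lemma exponent_mkLetter (c : Bool) {n : ℕ} (hn : 1 ≤ n ∧ n < k) :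
    (mkLetter c hn).exponent = n := ZMod.val_natCast_of_lt hn.2

lemma exponent_mem (hk : 3 ≤ k) (s : Letter k) : 1 ≤ s.exponent ∧ s.exponent < k := by
  have : NeZero k := ⟨by omega⟩
  refine ⟨Nat.one_le_iff_ne_zero.2 fun h => s.2 ?_, ZMod.val_lt _⟩
  exact (ZMod.val_eq_zero _).1 h

lemma letter_ext (hk : 3 ≤ k) {s t : Letter k} (h1 : s.factor = t.factor)
    (h2 : s.exponent = t.exponent) : s = t := by
  have : NeZero k := ⟨by omega⟩
  obtain ⟨⟨c, m⟩, hs⟩ := s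
  obtain ⟨⟨d, n⟩, ht⟩ := t
  obtain rfl : c = d := h1
  have : m = n := ZMod.val_injective k h2
  subst this
  rfl

lemma finsum_letter_ne (hk : 3 ≤ k) (f : ℕ → ℝ) (c : Bool) :
    ∑ᶠ s : {s : Letter k // s.factor ≠ c}, f s.1.exponent = ∑ i ∈ Finset.Ico 1 k, f i := by
  rw [← Finset.sum_coe_sort, ← finsum_eq_sum_of_fintype]
  symm
  refine finsum_eq_of_bijective (fun n : Finset.Ico 1 k =>
    (⟨mkLetter (!c) (Finset.mem_Ico.1 n.2), by simp [factor_mkLetter]⟩ :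
      {s : Letter k // s.factor ≠ c})) ⟨?_, ?_⟩ ?_
  · intro n m h
    have := congrArg (fun s => s.1.exponent) h
    simp only [exponent_mkLetter] at this
    exact Subtype.ext this
  · rintro ⟨s, hs⟩
    refine ⟨⟨s.exponent, Finset.mem_Ico.2 (exponent_mem hk s)⟩, Subtype.ext ?_⟩
    exact letter_ext hk (by rw [factor_mkLetter, Bool.eq_not_of_ne hs])
      (exponent_mkLetter _ (exponent_mem hk s))
  · intro n
    rw [exponent_mkLetter]

lemma finsum_letter (hk : 3 ≤ k) (f : ℕ → ℝ) :
    ∑ᶠ s : Letter k, f s.exponent = 2 * ∑ i ∈ Finset.Ico 1 k, f i := by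
  have h : ∑ p : Bool × Finset.Ico 1 k, f p.2 = 2 * ∑ i ∈ Finset.Ico 1 k, f i := by
    rw [Fintype.sum_prod_type, ← Finset.sum_coe_sort (Finset.Ico 1 k), Fintype.sum_bool]
    ring
  rw [← h, ← finsum_eq_sum_of_fintype]
  symm
  refine finsum_eq_of_bijective (fun p : Bool × Finset.Ico 1 k =>
    mkLetter p.1 (Finset.mem_Ico.1 p.2.2)) ⟨?_, ?_⟩ ?_
  · rintro ⟨c, n⟩ ⟨d, m⟩ h
    have h1 := congrArg Letter.factor h
    have h2 := congrArg Letter.exponent h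
    simp only [exponent_mkLetter, factor_mkLetter] at h1 h2
    exact Prod.ext h1 (Subtype.ext h2)
  · intro s
    exact ⟨⟨s.factor, s.exponent, Finset.mem_Ico.2 (exponent_mem hk s)⟩,
      letter_ext hk (factor_mkLetter _ _) (exponent_mkLetter _ _)⟩
  · intro p
    rw [exponent_mkLetter]

namespace IsSolution

variable {q x : ℝ}

lemma measure_letters (hk : 3 ≤ k) (h : IsSolution k q x) {Y : (ℕ → ZkZk k) → Boundary k}
    (hY : Measurable Y)
    (hlim : ∀ᵐ ω ∂(incrementLaw (stepLaw k)), ConvergesTo (walk ω) (Y ω)) {n : ℕ}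
    (u : Fin (n + 1) → Letter k) (hu : ∀ i : Fin n, (u i.castSucc).factor ≠ (u i.succ).factor) :
    incrementLaw (stepLaw k) {ω | ∀ i : Fin (n + 1), (Y ω).1 i = u i} =
      ENNReal.ofReal ((∏ i, F (u i).exponent x) / 2) := by
  set L : List (Syllable k) := List.ofFn fun i => (u i).1 with hL
  have hLr : Reduced L := by
    refine ⟨fun l hl => ?_, List.isChain_iff_getElem.2 fun i hi => ?_⟩
    · obtain ⟨i, rfl⟩ := (List.mem_ofFn' _ _).1 hl
      exact (u i).2
    · simp only [hL, List.length_ofFn] at hi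
      simp only [hL, List.getElem_ofFn]
      exact hu ⟨i, by omega⟩
  have hnf := normalForm_listProd hLr
  have hlen : len (listProd L) = n + 1 := by rw [len, hnf, hL, List.length_ofFn]
  have hne : listProd L ≠ 1 := fun h0 => by rw [h0, len_one] at hlen; omega
  have hw : weight (hitWeight k x) (listProd L) = ∏ i, F (u i).exponent x := by
    rw [weight, hnf, hL, List.map_ofFn, List.prod_ofFn]
    rfl
  rw [← hw, ← h.measure_prefix hk hY hlim hne, hlen, hnf]
  congr 1
  ext ω
  simp only [Set.mem_ofPred_eq]
  constructor
  · intro hω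
    refine List.ext_getElem (by simp [firstSyllables, hL]) fun i h1 h2 => ?_
    simp only [firstSyllables, hL, List.getElem_map, List.getElem_range, List.getElem_ofFn]
    simp only [hL, List.length_ofFn] at h2
    exact congrArg Subtype.val (hω ⟨i, h2⟩)
  · intro hω i
    have h1 := getElem?_firstSyllables (Y ω) i.2
    rw [hω, hL, List.getElem?_ofFn] at h1
    simp only [i.2, dite_true, Option.some.injEq] at h1
    exact Subtype.ext h1.symm

lemma transition_eq (hk : 3 ≤ k) (h : IsSolution k q x) {u v : Letter k}
    (huv : u.factor ≠ v.factor) :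
    transition (fun s : Letter k => F s.exponent x / 2) u v = F v.exponent x := by
  rw [transition, if_neg huv.symm, finsum_letter_ne hk (fun n => F n x / 2), ← Finset.sum_div,
    h.sum_F hk]
  ring

lemma isMarkovianMultiplicative (hk : 3 ≤ k) (h : IsSolution k q x)
    {Y : (ℕ → ZkZk k) → Boundary k} (hY : Measurable Y)
    (hlim : ∀ᵐ ω ∂(incrementLaw (stepLaw k)), ConvergesTo (walk ω) (Y ω)) :
    IsMarkovianMultiplicative (fun s : Letter k => F s.exponent x / 2)
      ((incrementLaw (stepLaw k)).map Y) where
  pos s := half_pos (h.F_pos hk (exponent_mem hk s).2.le)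
  sum_eq_one := by
    rw [finsum_letter hk (fun n => F n x / 2), ← Finset.sum_div, h.sum_F hk]
    norm_num
  isProbabilityMeasure := Measure.isProbabilityMeasure_map hY.aemeasurable
  cylinder n u := by
    have hm : MeasurableSet {w : Boundary k | ∀ i : Fin (n + 1), w.1 i = u i} := by
      simp only [Set.ofPred_forall]
      refine MeasurableSet.iInter fun i => ?_
      have hmi : Measurable fun w : Boundary k => w.1 i :=
        (measurable_pi_apply _).comp measurable_subtype_coe
      exact hmi (t := {u i}) trivial
    rw [Measure.map_apply hY hm]
    by_cases hu : ∀ i : Fin n, (u i.castSucc).factor ≠ (u i.succ).factor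
    · rw [Finset.prod_congr rfl fun i _ => h.transition_eq hk (hu i)]
      refine (h.measure_letters hk hY hlim u hu).trans ?_
      rw [Fin.prod_univ_succ]
      congr 1
      ring
    · push Not at hu
      obtain ⟨i, hi⟩ := hu
      rw [Finset.prod_eq_zero (Finset.mem_univ i), mul_zero, ENNReal.ofReal_zero]
      · convert measure_empty
        · ext ω
          simp only [Set.mem_preimage, Set.mem_ofPred_eq, Set.mem_empty_iff_false, iff_false]
          intro hω
          refine (Y ω).2 i ?_
          have h1 := hω i.castSucc
          have h2 := hω i.succ
          simp only [Fin.val_castSucc, Fin.val_succ] at h1 h2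
          rw [h1, h2, hi]
        · infer_instance
      · rw [transition, if_pos hi.symm]

end IsSolution

/-! ### The exponents of the limit word are independent -/

/-- The law of the exponents of the limit word. -/
def exponentLaw (k : ℕ) (x : ℝ) : Measure ℕ :=
  ∑ i ∈ Finset.Ico 1 k, ENNReal.ofReal (F i x) • Measure.dirac i

lemma exponentLaw_singleton (x : ℝ) (n : ℕ) :
    exponentLaw k x {n} = if n ∈ Finset.Ico 1 k then ENNReal.ofReal (F n x) else 0 := by
  rw [exponentLaw, Measure.finsetSum_apply]
  simp only [Measure.smul_apply, Measure.dirac_apply, Set.indicator_apply, Set.mem_singleton_iff,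
    Pi.one_apply, smul_eq_mul, mul_ite, mul_one, mul_zero]
  rw [Finset.sum_ite_eq']

lemma integral_exponentLaw (x : ℝ) (f : ℕ → ℝ) (hF : ∀ i ∈ Finset.Ico 1 k, 0 ≤ F i x) :
    ∫ n, f n ∂(exponentLaw k x) = ∑ i ∈ Finset.Ico 1 k, F i x * f i := by
  rw [exponentLaw, integral_finsetSum_measure]
  · refine Finset.sum_congr rfl fun i hi => ?_
    rw [integral_smul_measure, integral_dirac, ENNReal.toReal_ofReal (hF i hi), smul_eq_mul]
  · intro i _
    exact (integrable_dirac (by simp)).smul_measure ENNReal.ofReal_ne_top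

namespace IsSolution

variable {q x : ℝ}

lemma isProbabilityMeasure_exponentLaw (hk : 3 ≤ k) (h : IsSolution k q x) :
    IsProbabilityMeasure (exponentLaw k x) := by
  constructor
  rw [exponentLaw, Measure.finsetSum_apply]
  simp only [Measure.smul_apply, measure_univ, smul_eq_mul, mul_one]
  rw [← ENNReal.ofReal_sum_of_nonneg fun i hi => (h.F_pos hk (Finset.mem_Ico.1 hi).2.le).le,
    h.sum_F hk, ENNReal.ofReal_one]

lemma map_exponents (hk : 3 ≤ k) (h : IsSolution k q x) {Y : (ℕ → ZkZk k) → Boundary k}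
    (hY : Measurable Y)
    (hlim : ∀ᵐ ω ∂(incrementLaw (stepLaw k)), ConvergesTo (walk ω) (Y ω)) (n : ℕ) :
    (incrementLaw (stepLaw k)).map (fun ω (i : Fin (n + 1)) => ((Y ω).1 i).exponent) =
      Measure.pi fun _ => exponentLaw k x := by
  have := h.isProbabilityMeasure_exponentLaw hk
  have hme : ∀ i : ℕ, Measurable fun ω => ((Y ω).1 i).exponent := fun i =>
    (show Measurable (Letter.exponent (k := k)) from fun _ _ => trivial).comp
      ((measurable_pi_apply i).comp (measurable_subtype_coe.comp hY))
  have hmm : Measurable fun ω (i : Fin (n + 1)) => ((Y ω).1 i).exponent :=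
    measurable_pi_lambda _ fun i => hme i
  refine Measure.ext_of_singleton fun e => ?_
  rw [Measure.map_apply hmm (measurableSet_singleton e),
    Measure.pi_singleton]
  simp only [exponentLaw_singleton]
  by_cases he : ∀ i, e i ∈ Finset.Ico 1 k
  · simp only [he, if_true]
    have he' : ∀ i, 1 ≤ e i ∧ e i < k := fun i => Finset.mem_Ico.1 (he i)
    let u : Bool → Fin (n + 1) → Letter k := fun c i =>
      mkLetter (if Even (i : ℕ) then c else !c) (he' i)
    have hu : ∀ c (i : Fin n), (u c i.castSucc).factor ≠ (u c i.succ).factor := by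
      intro c i
      simp only [u, factor_mkLetter, Fin.val_castSucc, Fin.val_succ, Nat.even_add_one]
      by_cases hi : Even (i : ℕ) <;> simp [hi]
    have hset : (fun ω (i : Fin (n + 1)) => ((Y ω).1 i).exponent) ⁻¹' {e} =
        {ω | ∀ i : Fin (n + 1), (Y ω).1 i = u false i} ∪
          {ω | ∀ i : Fin (n + 1), (Y ω).1 i = u true i} := by
      ext ω
      simp only [Set.mem_preimage, Set.mem_singleton_iff, Set.mem_union, Set.mem_ofPred_eq]
      constructor
      · intro hω
        have hfac : ∀ i : ℕ, ((Y ω).1 i).factor =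
            if Even i then ((Y ω).1 0).factor else !((Y ω).1 0).factor := by
          intro i
          induction i with
          | zero => simp
          | succ i ih =>
            have h1 := (Y ω).2 i
            rw [ih] at h1
            simp only [Nat.even_add_one]
            by_cases hi : Even i
            · simp only [hi, if_true, not_true, if_false] at h1 ⊢
              revert h1
              cases ((Y ω).1 0).factor <;> cases ((Y ω).1 (i + 1)).factor <;> simp
            · simp only [hi, if_false, not_false_iff, if_true] at h1 ⊢
              revert h1
              cases ((Y ω).1 0).factor <;> cases ((Y ω).1 (i + 1)).factor <;> simp
        have hall : ∀ i : Fin (n + 1), (Y ω).1 i = u ((Y ω).1 0).factor i := fun i =>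
          letter_ext hk (by simp only [u, factor_mkLetter]; exact hfac i)
            (by simp only [u, exponent_mkLetter]; exact congrFun hω i)
        cases hc : ((Y ω).1 0).factor
        · exact Or.inl (hc ▸ hall)
        · exact Or.inr (hc ▸ hall)
      · rintro (hω | hω) <;> ext i <;> simp only [hω i, u, exponent_mkLetter]
    have hdisj : Disjoint {ω | ∀ i : Fin (n + 1), (Y ω).1 i = u false i}
        {ω | ∀ i : Fin (n + 1), (Y ω).1 i = u true i} := by
      rw [Set.disjoint_left]
      intro ω h1 h2
      have h3 := congrArg Letter.factor ((h1 0).symm.trans (h2 0))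
      simp [u, factor_mkLetter] at h3
    have hms : MeasurableSet {ω | ∀ i : Fin (n + 1), (Y ω).1 i = u true i} := by
      simp only [Set.ofPred_forall]
      refine MeasurableSet.iInter fun i => ?_
      have hmi : Measurable fun ω => (Y ω).1 i :=
        (measurable_pi_apply _).comp (measurable_subtype_coe.comp hY)
      exact hmi (t := {u true i}) trivial
    have hnn : 0 ≤ ∏ i, F (e i) x :=
      Finset.prod_nonneg fun i _ => (h.F_pos hk (he' i).2.le).le
    rw [hset, measure_union hdisj hms, h.measure_letters hk hY hlim _ (hu false),
      h.measure_letters hk hY hlim _ (hu true)]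
    simp only [u, exponent_mkLetter]
    rw [← ENNReal.ofReal_add (by linarith) (by linarith), add_halves,
      ENNReal.ofReal_prod_of_nonneg fun i _ => (h.F_pos hk (he' i).2.le).le]
  · push Not at he
    obtain ⟨i, hi⟩ := he
    rw [Finset.prod_eq_zero (Finset.mem_univ i) (if_neg hi)]
    convert measure_empty
    · ext ω
      simp only [Set.mem_preimage, Set.mem_singleton_iff, Set.mem_empty_iff_false, iff_false]
      rintro rfl
      exact hi (Finset.mem_Ico.2 (exponent_mem hk _))
    · infer_instance

lemma ae_tendsto_average (hk : 3 ≤ k) (h : IsSolution k q x) {Y : (ℕ → ZkZk k) → Boundary k}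
    (hY : Measurable Y)
    (hlim : ∀ᵐ ω ∂(incrementLaw (stepLaw k)), ConvergesTo (walk ω) (Y ω)) (f : ℕ → ℝ) :
    ∀ᵐ ω ∂(incrementLaw (stepLaw k)),
      Tendsto (fun n : ℕ => (∑ i ∈ Finset.range n, f ((Y ω).1 i).exponent) / n) atTop
        (𝓝 (∑ i ∈ Finset.Ico 1 k, F i x * f i)) := by
  have := h.isProbabilityMeasure_exponentLaw hk
  have hme : ∀ i : ℕ, Measurable fun ω => ((Y ω).1 i).exponent := fun i =>
    (show Measurable (Letter.exponent (k := k)) from fun _ _ => trivial).comp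
      ((measurable_pi_apply i).comp (measurable_subtype_coe.comp hY))
  have hlaw : ∀ i : ℕ, (incrementLaw (stepLaw k)).map (fun ω => ((Y ω).1 i).exponent) =
      exponentLaw k x := by
    intro i
    have h1 := congrArg (Measure.map fun e : Fin (i + 1) → ℕ => e (Fin.last i))
      (h.map_exponents hk hY hlim i)
    have hmm : Measurable fun ω (j : Fin (i + 1)) => ((Y ω).1 j).exponent :=
      measurable_pi_lambda _ fun j => hme j
    rw [Measure.map_map (measurable_pi_apply _) hmm] at h1
    exact h1.trans (measurePreserving_eval (fun _ : Fin (i + 1) => exponentLaw k x) _).map_eq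
  have hindep : ∀ i j : ℕ, i ≠ j → ProbabilityTheory.IndepFun
      (fun ω => ((Y ω).1 i).exponent) (fun ω => ((Y ω).1 j).exponent)
      (incrementLaw (stepLaw k)) := by
    intro i j hij
    have h1 : ProbabilityTheory.iIndepFun
        (fun (l : Fin (max i j + 1)) ω => ((Y ω).1 l).exponent) (incrementLaw (stepLaw k)) := by
      rw [ProbabilityTheory.iIndepFun_iff_map_fun_eq_pi_map fun l : Fin (max i j + 1) => (hme l).aemeasurable,
        h.map_exponents hk hY hlim]
      simp only [hlaw]
    exact h1.indepFun (i := ⟨i, by omega⟩) (j := ⟨j, by omega⟩) (by simpa using hij)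
  have hmf : Measurable f := Measurable.of_discrete
  have hint : Integrable f (exponentLaw k x) := by
    rw [exponentLaw, integrable_finsetSum_measure]
    exact fun i _ => (integrable_dirac (by simp)).smul_measure ENNReal.ofReal_ne_top
  have hslln := ProbabilityTheory.strong_law_ae_real
    (fun i ω => f ((Y ω).1 i).exponent) (μ := incrementLaw (stepLaw k))
    ?_ (fun i j hij => (hindep i j hij).comp hmf hmf) (fun i => ?_)
  · have hmean : ∫ ω, f ((Y ω).1 0).exponent ∂(incrementLaw (stepLaw k)) =
        ∑ i ∈ Finset.Ico 1 k, F i x * f i := by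
      rw [← integral_exponentLaw x f fun i hi => (h.F_pos hk (Finset.mem_Ico.1 hi).2.le).le,
        ← hlaw 0, integral_map (hme 0).aemeasurable hmf.aestronglyMeasurable]
    rwa [hmean] at hslln
  · rw [← hlaw 0] at hint
    exact hint.comp_measurable (hme 0)
  · have : ProbabilityTheory.IdentDistrib (fun ω => ((Y ω).1 i).exponent)
        (fun ω => ((Y ω).1 0).exponent) (incrementLaw (stepLaw k)) (incrementLaw (stepLaw k)) :=
      ⟨(hme i).aemeasurable, (hme 0).aemeasurable, (hlaw i).trans (hlaw 0).symm⟩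
    exact this.comp hmf

end IsSolution

end HarmonicMeasure

/-! ### The growth of the quadratic potential -/

section Potential

variable {k : ℕ}

/-- The quadratic potential of the exponent of a syllable. -/
def quad (k n : ℕ) : ℝ := n * (k - n)

/-- The sum of the quadratic potentials of the syllables. -/
def potential (g : ZkZk k) : ℝ :=
  ((normalForm g).map fun l => quad k (Multiplicative.toAdd l.2).val).sum

lemma quad_self : quad k k = quad k 0 := by simp [quad]

lemma weight_exp (θ : ℝ) (g : ZkZk k) :
    weight (fun m => Real.exp (θ * quad k m.val)) g = Real.exp (θ * potential g) := by
  rw [weight, potential, ← List.sum_map_mul_left, Real.exp_list_sum, List.map_map]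
  rfl

lemma exp_le_quadratic {y : ℝ} (hy : |y| ≤ 1) : Real.exp y ≤ 1 + y + y ^ 2 := by
  have := (abs_le.1 (Real.abs_exp_sub_one_sub_id_le hy)).2
  linarith

/-- The mean increment of the potential, off `1`. -/
def meanIncrement (k : ℕ) : ℝ := (k - 2) / 2

lemma expWeight_neighbours (hk : 3 ≤ k) {θ : ℝ} (hθ : |θ| * k ≤ 1) {m : ZMod k} (hm : m ≠ 0) :
    Real.exp (θ * quad k (m + 1).val) + Real.exp (θ * quad k (m - 1).val)
      + Real.exp (θ * quad k m.val)
        * (Real.exp (θ * quad k (1 : ZMod k).val) + Real.exp (θ * quad k (-1 : ZMod k).val))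
      ≤ 4 * Real.exp (θ * meanIncrement k + θ ^ 2 * k ^ 2) * Real.exp (θ * quad k m.val) := by
  rw [val_symm (f := quad k) hk (fun n l h => by subst h; simp only [quad]; push_cast; ring),
    val_one_eq (f := quad k) hk]
  refine val_neighbours (f := quad k) (P := fun u v w => Real.exp (θ * w) + Real.exp (θ * u)
    + Real.exp (θ * v) * (Real.exp (θ * quad k 1) + Real.exp (θ * quad k 1))
      ≤ 4 * Real.exp (θ * meanIncrement k + θ ^ 2 * k ^ 2) * Real.exp (θ * v)) hk quad_self ?_ hm
  intro n hn
  have hnk : (n : ℝ) + 2 ≤ k := by exact_mod_cast hn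
  have hn0 : (0 : ℝ) ≤ n := Nat.cast_nonneg n
  have hbound : ∀ d : ℝ, |d| ≤ k → Real.exp (θ * d) ≤ 1 + θ * d + θ ^ 2 * k ^ 2 := by
    intro d hd
    have h1 : |θ * d| ≤ 1 := by
      rw [abs_mul]
      exact (mul_le_mul_of_nonneg_left hd (abs_nonneg θ)).trans hθ
    have h2 : (θ * d) ^ 2 ≤ θ ^ 2 * k ^ 2 := by
      rw [mul_pow]
      exact mul_le_mul_of_nonneg_left (sq_le_sq.2 (hd.trans (le_abs_self _))) (sq_nonneg θ)
    linarith [exp_le_quadratic h1]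
  have e1 : θ * quad k (n + 2) = θ * quad k (n + 1) + θ * (k - 2 * n - 3) := by
    simp only [quad]; push_cast; ring
  have e2 : θ * quad k n = θ * quad k (n + 1) + θ * (-k + 2 * n + 1) := by
    simp only [quad]; push_cast; ring
  have e3 : quad k 1 = k - 1 := by simp [quad]
  rw [e1, e2, e3, Real.exp_add, Real.exp_add (θ * quad k (n + 1))]
  have b1 := hbound (k - 2 * n - 3) (abs_le.2 ⟨by linarith, by linarith⟩)
  have b2 := hbound (-k + 2 * n + 1) (abs_le.2 ⟨by linarith, by linarith⟩)
  have b3 := hbound (k - 1) (abs_le.2 ⟨by linarith, by linarith⟩)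
  have b4 := Real.add_one_le_exp (θ * meanIncrement k + θ ^ 2 * k ^ 2)
  have hpos := Real.exp_pos (θ * quad k (n + 1))
  have key : Real.exp (θ * (k - 2 * n - 3)) + Real.exp (θ * (-k + 2 * n + 1))
      + (Real.exp (θ * (k - 1)) + Real.exp (θ * (k - 1)))
      ≤ 4 * Real.exp (θ * meanIncrement k + θ ^ 2 * k ^ 2) := by
    simp only [meanIncrement] at b4 ⊢
    linarith
  have := mul_le_mul_of_nonneg_left key hpos.le
  linarith

lemma avg_expWeight_one (hk : 3 ≤ k) (θ : ℝ) :
    avg (weight fun m : ZMod k => Real.exp (θ * quad k m.val)) 1 = Real.exp (θ * (k - 1)) := by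
  rw [avg_weight_one (by simp [quad]),
    val_symm (f := quad k) hk (fun n l h => by subst h; simp only [quad]; push_cast; ring),
    val_one_eq (f := quad k) hk]
  simp [quad]

lemma avg_expWeight_le (hk : 3 ≤ k) {θ : ℝ} (hθ : |θ| * k ≤ 1) {g : ZkZk k} (hg : g ≠ 1) :
    avg (weight fun m : ZMod k => Real.exp (θ * quad k m.val)) g ≤
      Real.exp (θ * meanIncrement k + θ ^ 2 * k ^ 2) *
        weight (fun m : ZMod k => Real.exp (θ * quad k m.val)) g := by
  refine avg_weight_le (w := fun m : ZMod k => Real.exp (θ * quad k m.val)) (by simp [quad])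
    (fun m => (Real.exp_pos _).le) (fun m hm => ?_) hg
  exact expWeight_neighbours hk hθ hm

lemma exists_small (k : ℕ) {ε : ℝ} (hε : 0 < ε) : ∃ t : ℝ, 0 < t ∧ t * k ≤ 1 ∧ t * k ^ 2 < ε := by
  refine ⟨min (1 / (k + 1)) (ε / (k ^ 2 + 1)), by positivity, ?_, ?_⟩
  · calc _ ≤ 1 / ((k : ℝ) + 1) * k := mul_le_mul_of_nonneg_right (min_le_left _ _) (by positivity)
      _ ≤ 1 := by rw [div_mul_eq_mul_div, div_le_one (by positivity)]; linarith
  · calc _ ≤ ε / ((k : ℝ) ^ 2 + 1) * k ^ 2 :=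
          mul_le_mul_of_nonneg_right (min_le_right _ _) (by positivity)
      _ < ε := by
          rw [div_mul_eq_mul_div, div_lt_iff₀ (by positivity)]
          nlinarith

lemma ae_eventually_potential_le (hk : 3 ≤ k) {ε : ℝ} (hε : 0 < ε) :
    ∀ᵐ x ∂(incrementLaw (stepLaw k)), ∀ᶠ n : ℕ in atTop,
      potential (walk x n) ≤ (meanIncrement k + ε) * n := by
  obtain ⟨t, ht0, ht1, ht2⟩ := exists_small k hε
  have hk' : (3 : ℝ) ≤ k := by exact_mod_cast hk
  have hc : 0 < meanIncrement k := by unfold meanIncrement; linarith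
  set W : ZkZk k → ℝ := weight fun m => Real.exp (t * quad k m.val) with hW
  set ρ := Real.exp (t * meanIncrement k + t ^ 2 * k ^ 2) with hρ
  have hρ1 : 1 < ρ := Real.one_lt_exp_iff.2 (by positivity)
  set C := Real.exp (t * (k - 1)) / (ρ - 1) with hC
  have hρ0 : 0 < ρ - 1 := sub_pos.2 hρ1
  have hC0 : 0 ≤ C := by positivity
  have hCρ : C * (ρ - 1) = Real.exp (t * (k - 1)) := div_mul_cancel₀ _ hρ0.ne'
  have hWnn : ∀ g, 0 ≤ W g := weight_nonneg fun m => (Real.exp_pos _).le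
  have havg : ∀ g, avg (fun g => W g + C) g = avg W g + C := fun g => by
    simp only [avg]; ring
  have hle : ∀ g, avg (fun g => W g + C) g ≤ ρ * (W g + C) := by
    intro g
    rw [havg]
    by_cases hg : g = 1
    · subst hg
      rw [hW, avg_expWeight_one hk, weight_one]
      linarith
    · have h1 : avg W g ≤ ρ * W g := avg_expWeight_le hk (by rwa [abs_of_pos ht0]) hg
      have := mul_nonneg hC0 hρ0.le
      linarith
  have hlt : Real.exp (-(t * (meanIncrement k + ε))) * ρ < 1 := by
    rw [hρ, ← Real.exp_add, Real.exp_lt_one_iff]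
    have := mul_lt_mul_of_pos_left ht2 ht0
    linarith
  filter_upwards [ae_tendsto_zero_of_avg_le (f := fun g => W g + C)
    (fun g => add_nonneg (hWnn g) hC0) (by linarith) (Real.exp_pos _).le hlt hle] with x hx
  filter_upwards [hx.eventually_lt_const one_pos] with n hn
  have h1 : Real.exp (-(t * (meanIncrement k + ε))) ^ n * W (walk x n) < 1 :=
    lt_of_le_of_lt (mul_le_mul_of_nonneg_left (by linarith) (by positivity)) hn
  rw [hW, weight_exp, ← Real.exp_nat_mul, ← Real.exp_add, Real.exp_lt_one_iff] at h1
  have h2 : t * potential (walk x n) ≤ t * ((meanIncrement k + ε) * n) := by linarith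
  exact le_of_mul_le_mul_left h2 ht0

lemma ae_eventually_le_potential (hk : 3 ≤ k) {ε : ℝ} (hε : 0 < ε) :
    ∀ᵐ x ∂(incrementLaw (stepLaw k)), ∀ᶠ n : ℕ in atTop,
      (meanIncrement k - ε) * n ≤ potential (walk x n) := by
  obtain ⟨t, ht0, ht1, ht2⟩ := exists_small k hε
  have hk' : (3 : ℝ) ≤ k := by exact_mod_cast hk
  set W : ZkZk k → ℝ := weight fun m => Real.exp (-t * quad k m.val) with hW
  set ρ := Real.exp (-t * meanIncrement k + (-t) ^ 2 * k ^ 2) with hρ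
  have hWnn : ∀ g, 0 ≤ W g := weight_nonneg fun m => (Real.exp_pos _).le
  have hle : ∀ g, avg W g ≤ ρ * W g := by
    intro g
    by_cases hg : g = 1
    · subst hg
      rw [hW, avg_expWeight_one hk, weight_one, mul_one, hρ, Real.exp_le_exp]
      have h1 : t * meanIncrement k ≤ t * (k - 1) :=
        mul_le_mul_of_nonneg_left (by unfold meanIncrement; linarith) ht0.le
      have h2 : 0 ≤ (-t) ^ 2 * (k : ℝ) ^ 2 := by positivity
      linarith
    · exact avg_expWeight_le hk (by rwa [abs_neg, abs_of_pos ht0]) hg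
  have hlt : Real.exp (t * (meanIncrement k - ε)) * ρ < 1 := by
    rw [hρ, ← Real.exp_add, Real.exp_lt_one_iff]
    have := mul_lt_mul_of_pos_left ht2 ht0
    linarith
  filter_upwards [ae_tendsto_zero_of_avg_le hWnn (Real.exp_pos _).le (Real.exp_pos _).le hlt hle]
    with x hx
  filter_upwards [hx.eventually_lt_const one_pos] with n hn
  rw [hW, weight_exp, ← Real.exp_nat_mul, ← Real.exp_add, Real.exp_lt_one_iff] at hn
  have h2 : t * ((meanIncrement k - ε) * n) ≤ t * potential (walk x n) := by linarith
  exact le_of_mul_le_mul_left h2 ht0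

lemma ae_tendsto_potential (hk : 3 ≤ k) :
    ∀ᵐ x ∂(incrementLaw (stepLaw k)),
      Tendsto (fun n : ℕ => potential (walk x n) / n) atTop (𝓝 (meanIncrement k)) := by
  have hup := ae_all_iff.2 fun j : ℕ =>
    ae_eventually_potential_le hk (show (0 : ℝ) < 1 / ((j : ℝ) + 1) by positivity)
  have hlow := ae_all_iff.2 fun j : ℕ =>
    ae_eventually_le_potential hk (show (0 : ℝ) < 1 / ((j : ℝ) + 1) by positivity)
  filter_upwards [hup, hlow] with x h1 h2
  rw [Metric.tendsto_nhds]
  intro ε hε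
  obtain ⟨j, hj⟩ := exists_nat_one_div_lt hε
  filter_upwards [h1 j, h2 j, eventually_gt_atTop 0] with n h3 h4 hn
  have hn' : (0 : ℝ) < n := by exact_mod_cast hn
  rw [Real.dist_eq]
  refine lt_of_le_of_lt (abs_le.2 ⟨?_, ?_⟩) hj
  · have := (le_div_iff₀ hn').2 h4
    linarith
  · have := (div_le_iff₀ hn').2 h3
    linarith

end Potential

/-! ### The drift -/

section Drift

/-- If a sequence with increments at most `1` visits `m` for the last time at time `e m`, and
`m / e m` converges, then so does the mean of its increments. -/
lemma tendsto_div_of_last_visits {ℓ e : ℕ → ℕ} {γ : ℝ} (hγ : 0 < γ) (h0 : ℓ 0 = 0)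
    (hstep : ∀ n, ℓ (n + 1) ≤ ℓ n + 1) (he : ∀ m, ℓ (e m) = m)
    (hlt : ∀ m n, e m < n → m < ℓ n)
    (hlim : Tendsto (fun m : ℕ => (m : ℝ) / e m) atTop (𝓝 γ)) :
    Tendsto (fun n : ℕ => (ℓ n : ℝ) / n) atTop (𝓝 γ) := by
  have hadd : ∀ n j, ℓ (n + j) ≤ ℓ n + j := by
    intro n j
    induction j with
    | zero => rfl
    | succ j ih => exact (hstep (n + j)).trans (by omega)
  have hle : ∀ m, m ≤ e m := fun m => by
    have := hadd 0 (e m)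
    rwa [zero_add, h0, zero_add, he] at this
  have hpos : ∀ m, (0 : ℝ) < e (m + 1) := fun m => by
    have := hle (m + 1)
    exact_mod_cast (by omega : 0 < e (m + 1))
  have hA : Tendsto (fun m : ℕ => (m : ℝ) / e (m + 1)) atTop (𝓝 γ) := by
    have h1 := (hlim.comp (tendsto_add_atTop_nat 1)).mul (tendsto_natCast_div_add_atTop (1 : ℝ))
    rw [mul_one] at h1
    refine h1.congr fun m => ?_
    have := hpos m
    have hm : (m : ℝ) + 1 ≠ 0 := by positivity
    simp only [Function.comp_apply]
    push_cast
    field_simp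
  have hR : Tendsto (fun m : ℕ => (e m : ℝ) / e (m + 1)) atTop (𝓝 1) := by
    have h1 := hA.div hlim hγ.ne'
    rw [div_self hγ.ne'] at h1
    refine h1.congr' ?_
    filter_upwards [eventually_gt_atTop 0] with m hm
    have h2 := hpos m
    have h3 : (m : ℝ) ≠ 0 := by exact_mod_cast hm.ne'
    have h4 : (e m : ℝ) ≠ 0 := by
      have := hle m
      exact_mod_cast (by omega : e m ≠ 0)
    simp only [Pi.div_apply]
    field_simp
  have hB : Tendsto (fun m : ℕ => 1 - (e m : ℝ) / e (m + 1) + (m : ℝ) / e (m + 1)) atTop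
      (𝓝 γ) := by
    have := (hR.const_sub 1).add hA
    rwa [sub_self, zero_add] at this
  set M : ℕ → ℕ := fun n => Nat.findGreatest (fun m => e m ≤ n) n with hM
  have hMtop : Tendsto M atTop atTop := by
    refine tendsto_atTop.2 fun m => ?_
    filter_upwards [eventually_ge_atTop (e m)] with n hn
    exact Nat.le_findGreatest ((hle m).trans hn) hn
  have hM1 : ∀ n, e 0 ≤ n → e (M n) ≤ n := fun n hn =>
    Nat.findGreatest_spec (P := fun m => e m ≤ n) (Nat.zero_le n) hn
  have hM2 : ∀ n, n < e (M n + 1) := by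
    intro n
    by_contra! hc
    have := Nat.le_findGreatest (P := fun m => e m ≤ n) ((hle _).trans hc) hc
    exact absurd this (by simp [hM])
  have hlow : ∀ n, e 0 ≤ n → M n ≤ ℓ n := fun n hn => by
    rcases (hM1 n hn).eq_or_lt with h | h
    · conv_rhs => rw [← h, he]
    · exact (hlt _ _ h).le
  have hup : ∀ n, e 0 ≤ n → ℓ n + e (M n) ≤ M n + n := fun n hn => by
    have h1 := hadd (e (M n)) (n - e (M n))
    have h2 := hM1 n hn
    rw [he, Nat.add_sub_cancel' h2] at h1
    omega
  refine tendsto_of_tendsto_of_tendsto_of_le_of_le' (hA.comp hMtop) (hB.comp hMtop) ?_ ?_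
  · filter_upwards [eventually_ge_atTop (e 0), eventually_gt_atTop 0] with n hn hn0
    have hn' : (0 : ℝ) < n := by exact_mod_cast hn0
    have h1 : (M n : ℝ) ≤ ℓ n := by exact_mod_cast hlow n hn
    have h2 : (n : ℝ) ≤ e (M n + 1) := by exact_mod_cast (hM2 n).le
    exact div_le_div₀ (Nat.cast_nonneg _) h1 hn' h2
  · filter_upwards [eventually_ge_atTop (e 0), eventually_gt_atTop 0] with n hn hn0
    have hn' : (0 : ℝ) < n := by exact_mod_cast hn0
    have h1 : (ℓ n : ℝ) + e (M n) ≤ M n + n := by exact_mod_cast hup n hn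
    have h2 : (n : ℝ) ≤ e (M n + 1) := by exact_mod_cast (hM2 n).le
    have h3 : (M n : ℝ) ≤ e (M n) := by exact_mod_cast hle _
    have h4 : ((e (M n) : ℝ) - M n) / e (M n + 1) ≤ (e (M n) - M n) / n :=
      div_le_div_of_nonneg_left (by linarith) hn' h2
    have h5 : (ℓ n : ℝ) / n ≤ 1 - (e (M n) - M n) / n := by
      rw [div_le_iff₀ hn', sub_mul, div_mul_cancel₀ _ hn'.ne']
      linarith
    simp only [Function.comp_apply]
    rw [sub_div] at h4
    linarith

variable {k : ℕ} {q x : ℝ}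

lemma len_walk_le {ω : ℕ → ZkZk k} (hω : ∀ n, ∃ i m, ω n = ofFactor i m) (n : ℕ) :
    len (walk ω (n + 1)) ≤ len (walk ω n) + 1 := by
  obtain ⟨i, m, h⟩ := hω n
  rw [walk, h]
  exact len_mul_ofFactor_le _ _ _

namespace IsSolution

lemma ae_tendsto_len_div (hk : 3 ≤ k) (h : IsSolution k q x) :
    ∀ᵐ ω ∂(incrementLaw (stepLaw k)),
      Tendsto (fun n : ℕ => (len (walk ω n) : ℝ) / n) atTop (𝓝 ((1 - x) / 2)) := by
  obtain ⟨Y, hY, hlim⟩ := exists_measurable_limit hk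
  have hk' : (3 : ℝ) ≤ k := by exact_mod_cast hk
  have hx := h.x_lt_one
  set v := ∑ i ∈ Finset.Ico 1 k, F i x * quad k i with hv
  have hsum : (1 - x) * v = k - 2 := h.sum_F_mul hk
  have hvpos : 0 < v := pos_of_mul_pos_right (by rw [hsum]; linarith) (by linarith : 0 ≤ 1 - x)
  have hγ : meanIncrement k / v = (1 - x) / 2 := by
    rw [meanIncrement, ← hsum]
    field_simp
  filter_upwards [hlim, ae_forall_exists_ofFactor, ae_tendsto_potential hk,
    h.ae_tendsto_average hk hY (hlim.mono fun _ h => h.1) (quad k)] with ω h1 h2 h3 h4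
  obtain ⟨-, e, he⟩ := h1
  have hlen : ∀ m, len (walk ω (e m)) = m := fun m => by
    rw [len, (he m).1]; simp [firstSyllables]
  have h0 : len (walk ω 0) = 0 := len_one
  have hpot : ∀ m, potential (walk ω (e m)) =
      ∑ i ∈ Finset.range m, quad k ((Y ω).1 i).exponent := fun m => by
    rw [potential, (he m).1, firstSyllables, List.map_map, Finset.sum_range]
    rw [← List.sum_ofFn, List.ofFn_eq_map]
    rw [← List.map_coe_finRange_eq_range, List.map_map]
    rfl
  have hetop : Tendsto e atTop atTop := by
    refine tendsto_atTop_mono (fun m => ?_) tendsto_id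
    have : ∀ n, len (walk ω n) ≤ n := fun n => by
      induction n with
      | zero => rw [h0]
      | succ n ih => exact (len_walk_le h2 n).trans (by omega)
    simpa [hlen] using this (e m)
  refine tendsto_div_of_last_visits (by linarith) h0 (len_walk_le h2) hlen
    (fun m n hmn => (he m).2 n hmn) ?_
  have h5 := (h3.comp hetop).div h4 hvpos.ne'
  rw [hγ] at h5
  refine h5.congr' ?_
  filter_upwards [h4.eventually_const_lt hvpos, eventually_gt_atTop 0] with m hm hm0
  have hm' : (0 : ℝ) < m := by exact_mod_cast hm0
  have hne : ∑ i ∈ Finset.range m, quad k ((Y ω).1 i).exponent ≠ 0 := fun h0 => by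
    rw [h0, zero_div] at hm
    exact lt_irrefl _ hm
  simp only [Pi.div_apply, Function.comp_apply, hpot]
  rw [div_div_div_comm, div_self hne, one_div_div]

lemma isDrift (hk : 3 ≤ k) (h : IsSolution k q x) :
    IsDrift (generators k) (stepLaw k) ((1 - x) / 2) := by
  refine ⟨by simpa only [wordLength_generators] using h.ae_tendsto_len_div hk, ?_⟩
  simp only [wordLength_generators, eLpNorm_one_eq_lintegral_enorm]
  have hmain : Tendsto (fun n : ℕ => ∫⁻ ω, ‖(len (walk ω n) : ℝ) / n - (1 - x) / 2‖ₑ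
      ∂(incrementLaw (stepLaw k))) atTop (𝓝 (∫⁻ _, 0 ∂(incrementLaw (stepLaw k)))) := by
    refine tendsto_lintegral_of_dominated_convergence
      (fun _ => ENNReal.ofReal (1 + |(1 - x) / 2|)) (fun n => ?_) (fun n => ?_) (by simp) ?_
    · exact (Measurable.of_discrete (f := fun g : ZkZk k =>
        ‖(len g : ℝ) / n - (1 - x) / 2‖ₑ)).comp (measurable_walk n)
    · filter_upwards [ae_forall_exists_ofFactor] with ω hω
      have hle : ∀ n, len (walk ω n) ≤ n := fun n => by
        induction n with
        | zero => exact len_one.le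
        | succ n ih => exact (len_walk_le hω n).trans (by omega)
      rw [← ofReal_norm]
      refine ENNReal.ofReal_le_ofReal ((norm_sub_le _ _).trans (add_le_add ?_ le_rfl))
      rw [Real.norm_of_nonneg (by positivity)]
      exact div_le_one_of_le₀ (by exact_mod_cast hle n) (Nat.cast_nonneg n)
    · filter_upwards [h.ae_tendsto_len_div hk] with ω hω
      have := (hω.sub_const ((1 - x) / 2)).enorm
      simpa using this
  simpa using hmain

end IsSolution

end Drift

end FreeProductWalk

end

theorem mainTheorem1 :
    ∃ x γ : ℕ → ℝ,
      (∀ k : ℕ, 3 ≤ k →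
        (0 < x k ∧ x k < 1 ∧ FreeProductWalk.F k (x k) = 1 ∧
          ∀ y : ℝ, 0 < y → y < 1 → FreeProductWalk.F k y = 1 → y = x k) ∧
        (∃ ν : MeasureTheory.Measure (FreeProductWalk.Boundary k),
          FreeProductWalk.IsHarmonicMeasure (FreeProductWalk.stepLaw k) ν ∧
          FreeProductWalk.IsMarkovianMultiplicative
            (fun s : FreeProductWalk.Letter k => FreeProductWalk.F s.exponent (x k) / 2) ν) ∧
        FreeProductWalk.IsDrift (FreeProductWalk.generators k) (FreeProductWalk.stepLaw k) (γ k) ∧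
        γ k = (1 - x k) / 2) ∧
      StrictMonoOn γ (Set.Ici 3) ∧
      Filter.Tendsto γ Filter.atTop (nhds (1 / 3)) := by
  have hex : ∀ k : ℕ, ∃ q x : ℝ, 3 ≤ k → FreeProductWalk.IsSolution k q x := fun k => by
    by_cases hk : 3 ≤ k
    · obtain ⟨q, x, h⟩ := FreeProductWalk.exists_isSolution hk
      exact ⟨q, x, fun _ => h⟩
    · exact ⟨0, 0, fun h => absurd h hk⟩
  choose q x h using hex
  refine ⟨x, fun k => (1 - x k) / 2, fun k hk => ⟨⟨(h k hk).x_pos hk, (h k hk).x_lt_one,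
    (h k hk).F_self hk, fun y => (h k hk).unique hk⟩, ?_, (h k hk).isDrift hk, rfl⟩, ?_, ?_⟩
  · obtain ⟨Y, hY, hlim⟩ := FreeProductWalk.exists_measurable_limit hk
    have hconv := hlim.mono fun _ h => h.1
    exact ⟨_, ⟨Y, hY.aemeasurable, hconv, rfl⟩, (h k hk).isMarkovianMultiplicative hk hY hconv⟩
  · refine strictMonoOn_of_lt_add_one Set.ordConnected_Ici fun k _ hk _ => ?_
    have := (h k hk).x_strictAnti hk (h (k + 1) (le_trans hk (Nat.le_succ k)))
    linarith
  · have := ((FreeProductWalk.tendsto_solution h).const_sub 1).div_const 2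
    norm_num at this
    simpa using this
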